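/- **Theorem 3.4 (variation formula behind the $\mu$ function).** Let $L$ be a (possibly infinite-dimensional) Lie group modelled on a Hausdorff locally convex real vector space, with smoothness understood in the sense of Michal–Bastiani–Milnor, and let $\mathcal L$ be its Lie algebra. Let $w:\mathcal L\times\mathcal L\to\mathbb C$ be a continuous 2-cocycle, that is, a continuous skew-symmetric real-bilinear map with $$w([\xi_1,\xi_2],\xi_3)+w([\xi_2,\xi_3],\xi_1)+w([\xi_3,\xi_1],\xi_2)=0\qquad(\xi_i\in\mathcal L),$$ and denote also by $w$ the left-invariant 2-form on $L$ it defines, $w_g(X,Y)=w(g^{-1}X,g^{-1}Y)$. (This covers in particular every integral 2-cocycle compatible with a splitting $L_\pm$ of $L$, i.e. one vanishing on $\mathcal L_+$ and on $\mathcal L_-$; neither integrality nor compatibility is required for the formula.) Let $B=\{(x,y)\in\mathbb R^2: x^2+y^2\le 1\}$, let $h:(-r,r)\times B\to L$ be a smooth map (in charts, it is continuous, it is smooth in the interior, and all its derivatives extend continuously to the boundary), and put $h_\epsilon=h(\epsilon,\cdot)$. Then for every $\epsilon\in(-r,r)$ both integrals below converge, the function $\epsilon\mapsto\int_B h_\epsilon^*w=\int_B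 w(h^{-1}\partial_xh,\,h^{-1}\partial_yh)\,dx\,dy$ is differentiable, and $$\frac{d}{d\epsilon}\int_B h_\epsilon^*w=\int_{\partial B}w\big(h^{-1}\partial_\epsilon h,\;h^{-1}\partial_sh\big)\,ds ,$$ where $\partial B$ is parametrized counterclockwise by $s\mapsto(\cos s,\sin s)$, $0\le s\le 2\pi$. -/

import Mathlib

open Set Filter Topology MeasureTheory

namespace LCLie

universe u v w

/-! ### Differential calculus in locally convex spaces -/

section Calculus

variable {F : Type v} [AddCommGroup F] [Module ℝ F] [TopologicalSpace F] [ContinuousSMul ℝ F]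

/-- `f` is of class `C^k` on `S` in the sense of Michal and Bastiani: `f` is continuous on `S`, the
directional derivatives `df (x, v)` exist at the interior points `x` of `S`, and
`df` (extended to `S × E`, which for `S` with dense interior is possible in at most one way that is
continuous) is of class `C^(k-1)` on `S × E`. For open `S` this is the usual notion of a
`C^k` map between locally convex spaces; for a set with dense interior (a closed disk, say) it
says that all the derivatives in the interior extend continuously to `S`. -/
def CkOn : ℕ → ∀ {E : Type u} [AddCommGroup E] [Module ℝ E] [TopologicalSpace E],
    (E → F) → Set E → Prop
  | 0, _, _, _, _, f, S => ContinuousOn f S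
  | k + 1, E, _, _, _, f, S => ContinuousOn f S ∧
      ∃ df : E × E → F,
        (∀ x ∈ interior S, ∀ v : E, HasDerivAt (fun t : ℝ => f (x + t • v)) (df (x, v)) 0) ∧
        CkOn k df (S ×ˢ (univ : Set E))

/-- `f` is smooth (of class `C^∞`) on `S`. -/
def SmoothOn {E : Type u} [AddCommGroup E] [Module ℝ E] [TopologicalSpace E]
    (f : E → F) (S : Set E) : Prop :=
  ∀ k : ℕ, CkOn k f S

end Calculus

/-! ### Lie groups modelled on a locally convex space -/

section Group

variable (E : Type v) [AddCommGroup E] [Module ℝ E] [TopologicalSpace E]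

/-- `L` is a (possibly infinite-dimensional) Lie group modelled on the locally convex space `E`: a
smooth manifold modelled on `E` with smooth multiplication and inversion. -/
class IsLieGroup [ContinuousSMul ℝ E] (L : Type w) [TopologicalSpace L]
    [ChartedSpace E L] [Group L] : Prop extends IsTopologicalGroup L where
  smooth_chartChange : ∀ e ∈ atlas E L, ∀ e' ∈ atlas E L,
    SmoothOn (fun x : E => e' (e.symm x)) {x | x ∈ e.target ∧ e.symm x ∈ e'.source}
  smooth_mul : ∀ e₁ ∈ atlas E L, ∀ e₂ ∈ atlas E L, ∀ e₃ ∈ atlas E L,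
    SmoothOn (fun p : E × E => e₃ (e₁.symm p.1 * e₂.symm p.2))
      {p | p.1 ∈ e₁.target ∧ p.2 ∈ e₂.target ∧ e₁.symm p.1 * e₂.symm p.2 ∈ e₃.source}
  smooth_inv : ∀ e₁ ∈ atlas E L, ∀ e₂ ∈ atlas E L,
    SmoothOn (fun x : E => e₂ (e₁.symm x)⁻¹) {x | x ∈ e₁.target ∧ (e₁.symm x)⁻¹ ∈ e₂.source}

/-- `h` is a smooth map from `S`, a subset of a vector space, to the manifold `L`. -/
def SmoothMapOn [ContinuousSMul ℝ E] {L : Type w} [TopologicalSpace L] [ChartedSpace E L]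
    {V : Type u} [AddCommGroup V] [Module ℝ V] [TopologicalSpace V] (h : V → L) (S : Set V) :
    Prop :=
  ContinuousOn h S ∧
    ∀ e ∈ atlas E L, SmoothOn (fun x : V => e (h x)) (S ∩ h ⁻¹' e.source)

variable {L : Type w} [TopologicalSpace L] [ChartedSpace E L] [Group L]

variable (L) in
/-- The left-invariant vector field `g ↦ g v` on `L`, read in the preferred chart `φ` at the
identity, through which the tangent space of `L` at the identity is identified with `E`. -/
noncomputable def leftInvField (v : E) (x : E) : E :=
  deriv (fun t : ℝ => chartAt E (1 : L)
    ((chartAt E (1 : L)).symm x *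
      (chartAt E (1 : L)).symm (chartAt E (1 : L) 1 + t • v))) 0

variable (L) in
/-- The Lie bracket on the Lie algebra `E` (the tangent space at the identity) of `L`: the value at
the identity of the bracket `[X, Y] = DY(X) - DX(Y)` of the left-invariant vector fields. -/
noncomputable def bracket (v w : E) : E :=
  deriv (fun t : ℝ => leftInvField E L w
      (chartAt E (1 : L) 1 + t • leftInvField E L v (chartAt E (1 : L) 1))) 0 -
    deriv (fun t : ℝ => leftInvField E L v
      (chartAt E (1 : L) 1 + t • leftInvField E L w (chartAt E (1 : L) 1))) 0

/-- The left logarithmic derivative `γ⁻¹ γ'` at time `t` of a curve `γ` in `L`: the velocity at the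
identity, in the tangent space `E`, of the left-translated curve `τ ↦ γ(t)⁻¹ γ(τ)`. -/
noncomputable def leftLogDeriv (γ : ℝ → L) (t : ℝ) : E :=
  deriv (fun τ : ℝ => chartAt E (1 : L) ((γ t)⁻¹ * γ τ)) t

variable (L) in
/-- A continuous complex-valued 2-cocycle on the Lie algebra of `L`. -/
structure IsTwoCocycle (ω : E →ₗ[ℝ] E →ₗ[ℝ] ℂ) : Prop where
  continuous : Continuous fun p : E × E => ω p.1 p.2
  skew : ∀ ξ η : E, ω ξ η = -ω η ξ
  cocycle : ∀ ξ₁ ξ₂ ξ₃ : E,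
    ω (bracket E L ξ₁ ξ₂) ξ₃ + ω (bracket E L ξ₂ ξ₃) ξ₁ + ω (bracket E L ξ₃ ξ₁) ξ₂ = 0

variable {E}

/-- The coefficient of `dx ∧ dy` in `f^* ω`, where `f` is a map from the plane to `L` and `ω`
stands for the left-invariant 2-form on `L` that it defines, `ω_g (X, Y) = ω (g⁻¹ X, g⁻¹ Y)`. -/
noncomputable def pullback (ω : E →ₗ[ℝ] E →ₗ[ℝ] ℂ) (f : ℝ × ℝ → L) (p : ℝ × ℝ) : ℂ :=
  ω (leftLogDeriv E (fun x : ℝ => f (x, p.2)) p.1) (leftLogDeriv E (fun y : ℝ => f (p.1, y)) p.2)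

end Group

/-- The closed unit disk in the plane. -/
def unitDisk : Set (ℝ × ℝ) := {p | p.1 ^ 2 + p.2 ^ 2 ≤ 1}

end LCLie

/-!
The theorem is Stokes' theorem for a closed 2-form in disguise. Let `A = h⁻¹ dh` be the pullback
under `h` of the left Maurer–Cartan form; it is a 1-form on `(-r, r) × B` with values in the Lie
algebra `E`, and `h^* ω = ω(A, A)`. The structure equation `∂_v A_w - ∂_w A_v = -[A_v, A_w]` and
the cocycle identity say that `ω(A, A)` is closed. In cylindrical coordinates `(ε, ρ, s)` this is the
equation `∂_ε ω(A_ρ, A_s) - ∂_ρ ω(A_ε, A_s) + ∂_s ω(A_ε, A_ρ) = 0`, and the divergence theorem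
on the box `[a, b] × [0, 1] × [-π, π]` gives
`∫_B h_b^* ω - ∫_B h_a^* ω = ∫_a^b ∫ ω(A_ε, A_s) ds dε`, the last integrand taken at `ρ = 1`: the
faces `s = ±π` cancel, and `A_s = 0` at `ρ = 0`. Differentiation in `b` gives the formula. The
divergence theorem asks for differentiability only inside the box and for continuity up to its
boundary, so nothing beyond the continuity of `A` is needed on the boundary of the disk.

The model space `E` is merely locally convex, so the calculus rests on Hadamard derivatives
(`HasHadamardDerivWithinAt`): the chain rule is immediate for them, they agree with Fréchet derivatives
in finite dimensions, and maps of class `C^1` in the sense of Michal and Bastiani have them, up to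
the boundary, by a mean value theorem obtained from the Hahn–Banach theorem
(`quotient_mem_of_forall_segment_mem`, `CkOn.exists_hasHadamardDerivWithinAt`). The form `A` is
built in charts and glued by uniqueness of derivatives (`exists_isMaurerCartanOn`). The structure
equation (`IsMaurerCartanOn.structure_equation`) comes from the symmetry of second derivatives,
applied to the left translate `h(p)⁻¹ h` in the chart at the identity. Closedness in coordinates is
`IsMaurerCartanOn.exists_hasFDerivAt_closed`, and the integral formula is
`integral_sub_eq_of_closed`.
-/

namespace LCLie

/-! ### Hadamard derivatives -/

section Hadamard

variable {V : Type*} [AddCommGroup V] [Module ℝ V] [TopologicalSpace V]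
variable {F : Type*} [AddCommGroup F] [Module ℝ F] [TopologicalSpace F]
variable {G : Type*} [AddCommGroup G] [Module ℝ G] [TopologicalSpace G]

/-- The pairs `(t, v')` with `t → 0`, `t ≠ 0`, `v' → v` and `x + t v' ∈ S`, along which the
difference quotients at `x` within `S` in the direction `v` are taken. -/
def quotFilter (S : Set V) (x v : V) : Filter (ℝ × V) :=
  (𝓝[≠] (0 : ℝ) ×ˢ 𝓝 v) ⊓ 𝓟 {q | x + q.1 • q.2 ∈ S}

/-- `f` is Hadamard differentiable within `S` at `x` with derivative `f'`: the quotients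
`(f (x + t v') - f x) / t` converge to `f' v` when `t → 0` and `v' → v` jointly, with
`x + t v' ∈ S`. Varying the direction along with `t` makes the chain rule automatic, while
no norm and no topology on the space of linear maps is needed. Continuity of `f'` is not part
of the definition. -/
def HasHadamardDerivWithinAt (f : V → F) (f' : V →ₗ[ℝ] F) (S : Set V) (x : V) : Prop :=
  ∀ v, Tendsto (fun q : ℝ × V => q.1⁻¹ • (f (x + q.1 • q.2) - f x)) (quotFilter S x v) (𝓝 (f' v))

variable {f : V → F} {f' : V →ₗ[ℝ] F} {S T : Set V} {x v : V}

theorem eventually_quotFilter_ne : ∀ᶠ q in quotFilter S x v, q.1 ≠ 0 :=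
  mem_inf_of_left ((eventually_mem_nhdsWithin (a := (0 : ℝ)) (s := {0}ᶜ)).prod_inl _)

theorem eventually_quotFilter_mem : ∀ᶠ q in quotFilter S x v, x + q.1 • q.2 ∈ S :=
  mem_inf_of_right (mem_principal_self _)

theorem tendsto_fst_quotFilter : Tendsto Prod.fst (quotFilter S x v) (𝓝[≠] (0 : ℝ)) :=
  tendsto_fst.mono_left inf_le_left

theorem tendsto_snd_quotFilter : Tendsto Prod.snd (quotFilter S x v) (𝓝 v) :=
  tendsto_snd.mono_left inf_le_left

theorem tendsto_quotFilter_iff {α : Type*} {l : Filter α} {a : α → ℝ × V} :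
    Tendsto a l (quotFilter S x v) ↔ Tendsto (fun i => (a i).1) l (𝓝[≠] 0) ∧
      Tendsto (fun i => (a i).2) l (𝓝 v) ∧ ∀ᶠ i in l, x + (a i).1 • (a i).2 ∈ S := by
  unfold quotFilter
  rw [tendsto_inf, tendsto_principal, tendsto_prod_iff', and_assoc]
  rfl

theorem tendsto_add_smul_quotFilter [ContinuousAdd V] [ContinuousSMul ℝ V] :
    Tendsto (fun q : ℝ × V => x + q.1 • q.2) (quotFilter S x v) (𝓝[S] x) := by
  refine tendsto_nhdsWithin_iff.2 ⟨?_, eventually_quotFilter_mem⟩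
  have h := (tendsto_fst_quotFilter.mono_right nhdsWithin_le_nhds).smul
    (tendsto_snd_quotFilter (S := S) (x := x) (v := v))
  simpa using h.const_add x

theorem HasHadamardDerivWithinAt.mono (h : HasHadamardDerivWithinAt f f' S x) (hT : T ⊆ S) :
    HasHadamardDerivWithinAt f f' T x := fun v =>
  (h v).mono_left (inf_le_inf_left _ (principal_mono.2 fun _ hq => hT hq))

theorem HasHadamardDerivWithinAt.mono_of_mem_nhdsWithin [ContinuousAdd V] [ContinuousSMul ℝ V]
    (h : HasHadamardDerivWithinAt f f' T x) (hT : T ∈ 𝓝[S] x) :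
    HasHadamardDerivWithinAt f f' S x := fun v =>
  (h v).mono_left <| le_inf inf_le_left <| le_principal_iff.2 <|
    tendsto_add_smul_quotFilter.eventually hT

theorem HasHadamardDerivWithinAt.congr [ContinuousAdd V] [ContinuousSMul ℝ V] {g : V → F}
    (h : HasHadamardDerivWithinAt f f' S x) (hg : g =ᶠ[𝓝[S] x] f) (hx : g x = f x) :
    HasHadamardDerivWithinAt g f' S x := fun v =>
  (h v).congr' ((tendsto_add_smul_quotFilter.eventually hg).mono fun q hq => by simp only [hq, hx])

theorem HasHadamardDerivWithinAt.comp {g : F → G} {g' : F →ₗ[ℝ] G} {T : Set F}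
    (hg : HasHadamardDerivWithinAt g g' T (f x)) (hf : HasHadamardDerivWithinAt f f' S x)
    (hST : MapsTo f S T) : HasHadamardDerivWithinAt (fun y => g (f y)) (g' ∘ₗ f') S x := by
  intro v
  have key : ∀ q : ℝ × V, q.1 ≠ 0 →
      f x + q.1 • q.1⁻¹ • (f (x + q.1 • q.2) - f x) = f (x + q.1 • q.2) := fun q hq => by
    rw [smul_inv_smul₀ hq]; abel
  have ht : Tendsto (fun q : ℝ × V => (q.1, q.1⁻¹ • (f (x + q.1 • q.2) - f x)))
      (quotFilter S x v) (quotFilter T (f x) (f' v)) := by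
    refine tendsto_quotFilter_iff.2 ⟨tendsto_fst_quotFilter, hf v, ?_⟩
    filter_upwards [eventually_quotFilter_ne, eventually_quotFilter_mem] with q hq hqS
    rw [key q hq]
    exact hST hqS
  refine ((hg (f' v)).comp ht).congr' ?_
  filter_upwards [eventually_quotFilter_ne] with q hq
  simp only [Function.comp_apply, key q hq]

theorem HasHadamardDerivWithinAt.prodMk {g : V → G} {g' : V →ₗ[ℝ] G}
    (hf : HasHadamardDerivWithinAt f f' S x) (hg : HasHadamardDerivWithinAt g g' S x) :
    HasHadamardDerivWithinAt (fun y => (f y, g y)) (f'.prod g') S x := fun v =>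
  (hf v).prodMk_nhds (hg v)

theorem hasHadamardDerivWithinAt_const (c : F) :
    HasHadamardDerivWithinAt (fun _ : V => c) 0 S x := fun v => by
  simpa using tendsto_const_nhds

theorem hasHadamardDerivWithinAt_linear (l : V →ₗ[ℝ] F) (hl : Continuous l) :
    HasHadamardDerivWithinAt l l S x := fun v => by
  refine ((hl.tendsto v).comp tendsto_snd_quotFilter).congr' ?_
  filter_upwards [eventually_quotFilter_ne] with q hq
  simp [map_add, map_smul, inv_smul_smul₀ hq]

theorem HasHadamardDerivWithinAt.tendsto_ray (hf : HasHadamardDerivWithinAt f f' S x)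
    {l : Filter ℝ} (hl : l ≤ 𝓝[≠] 0) (hv : ∀ᶠ t : ℝ in l, x + t • v ∈ S) :
    Tendsto (fun t : ℝ => t⁻¹ • (f (x + t • v) - f x)) l (𝓝 (f' v)) :=
  (hf v).comp (tendsto_quotFilter_iff.2 ⟨tendsto_id.mono_left hl, tendsto_const_nhds, hv⟩ :
    Tendsto (fun t : ℝ => (t, v)) l _)

/-- Derivatives within a convex set with interior points are unique, since the directions pointing
into the set span the space. -/
theorem HasHadamardDerivWithinAt.unique [IsTopologicalAddGroup V] [ContinuousSMul ℝ V] [T2Space F]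
    {f'' : V →ₗ[ℝ] F} (h₁ : HasHadamardDerivWithinAt f f' S x)
    (h₂ : HasHadamardDerivWithinAt f f'' S x) (hS : Convex ℝ S) (hSi : (interior S).Nonempty)
    (hx : x ∈ S) : f' = f'' := by
  have key : ∀ y ∈ S, f' (y - x) = f'' (y - x) := by
    intro y hy
    have hl : 𝓝[>] (0 : ℝ) ≤ 𝓝[≠] 0 := nhdsWithin_mono _ fun t ht => ne_of_gt ht
    have hv : ∀ᶠ t : ℝ in 𝓝[>] 0, x + t • (y - x) ∈ S := by
      filter_upwards [Ioc_mem_nhdsGT (zero_lt_one' ℝ)] with t ht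
      exact hS.add_smul_sub_mem hx hy ⟨ht.1.le, ht.2⟩
    exact tendsto_nhds_unique (h₁.tendsto_ray hl hv) (h₂.tendsto_ray hl hv)
  obtain ⟨y, hy⟩ := hSi
  ext v
  have hc : ∀ᶠ t : ℝ in 𝓝[≠] 0, y + t • v ∈ S := by
    have : Tendsto (fun t : ℝ => y + t • v) (𝓝 0) (𝓝 (y + (0 : ℝ) • v)) :=
      Continuous.tendsto (by fun_prop) 0
    rw [zero_smul, add_zero] at this
    exact (this.eventually (mem_interior_iff_mem_nhds.1 hy)).filter_mono nhdsWithin_le_nhds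
  obtain ⟨t, ht, ht0⟩ := (hc.and eventually_mem_nhdsWithin).exists
  have e : t • v = (y + t • v - x) - (y - x) := by abel
  have h := congrArg₂ (· - ·) (key _ ht) (key _ (interior_subset hy))
  simp only [← map_sub, ← e, map_smul] at h
  exact smul_right_injective _ ht0 h

end Hadamard

section Curves

variable {F : Type*} [AddCommGroup F] [Module ℝ F] [TopologicalSpace F] [IsTopologicalAddGroup F]
  [ContinuousSMul ℝ F]

theorem hasDerivAt_iff_tendsto_quotient {γ : ℝ → F} {v : F} {t : ℝ} :
    HasDerivAt γ v t ↔ Tendsto (fun s : ℝ => s⁻¹ • (γ (t + s) - γ t)) (𝓝[≠] 0) (𝓝 v) := by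
  rw [hasDerivAt_iff_hasFDerivAt, hasFDerivAt_iff_isLittleOTVS,
    Asymptotics.isLittleOTVS_iff_tendsto_inv_smul (Eventually.of_forall fun s hs => by
      simp [sub_eq_zero.1 hs])]
  have hmap : 𝓝 t = map (fun s => t + s) (𝓝 0) := by simp
  rw [hmap, tendsto_map'_iff]
  have h0 : Tendsto ((fun s : ℝ => (s - t)⁻¹ • (γ s - γ t -
        (ContinuousLinearMap.toSpanSingleton ℝ v) (s - t))) ∘ fun s => t + s) (𝓝 0) (𝓝 0) ↔
      Tendsto ((fun s : ℝ => (s - t)⁻¹ • (γ s - γ t -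
        (ContinuousLinearMap.toSpanSingleton ℝ v) (s - t))) ∘ fun s => t + s) (𝓝[≠] 0) (𝓝 0) := by
    refine ⟨fun h => h.mono_left nhdsWithin_le_nhds, fun h => ?_⟩
    rw [← nhdsNE_sup_pure, tendsto_sup]
    refine ⟨h, ?_⟩
    rw [tendsto_pure_left]
    intro s hs
    simpa using mem_of_mem_nhds hs
  rw [h0]
  have h1 : ((fun s : ℝ => (s - t)⁻¹ • (γ s - γ t -
        (ContinuousLinearMap.toSpanSingleton ℝ v) (s - t))) ∘ fun s => t + s) =ᶠ[𝓝[≠] 0]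
      fun s : ℝ => s⁻¹ • (γ (t + s) - γ t) - v := by
    filter_upwards [eventually_mem_nhdsWithin] with s hs
    simp only [Function.comp_apply, add_sub_cancel_left,
      ContinuousLinearMap.toSpanSingleton_apply, smul_sub]
    rw [inv_smul_smul₀ hs]
  rw [tendsto_congr' h1]
  constructor
  · intro h; simpa using h.add_const v
  · intro h; simpa using h.sub_const v

theorem hasHadamardDerivWithinAt_of_hasDerivAt {γ : ℝ → F} {v : F} {t : ℝ} {S : Set ℝ}
    (h : HasDerivAt γ v t) : HasHadamardDerivWithinAt γ (LinearMap.toSpanSingleton ℝ F v) S t := by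
  intro c
  have h1 := h.hasFDerivAt
  rw [hasFDerivAt_iff_isLittleOTVS] at h1
  have h2 := h1.tendsto_inv_smul
  have h3 : Tendsto (fun q : ℝ × ℝ => t + q.1 • q.2) (quotFilter S t c) (𝓝 t) :=
    tendsto_add_smul_quotFilter.mono_right nhdsWithin_le_nhds
  have h4 := (tendsto_snd_quotFilter (S := S) (x := t) (v := c)).smul (h2.comp h3)
  have h5 := h4.add ((tendsto_snd_quotFilter (S := S) (x := t) (v := c)).smul_const v)
  simp only [smul_zero, zero_add] at h5
  rw [LinearMap.toSpanSingleton_apply]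
  refine h5.congr' ?_
  filter_upwards [eventually_quotFilter_ne] with q hq
  rcases eq_or_ne q.2 0 with h0 | h0
  · simp [h0]
  · simp only [Function.comp_apply, add_sub_cancel_left, smul_eq_mul, mul_inv, smul_sub, smul_smul,
      ContinuousLinearMap.toSpanSingleton_apply]
    have e1 : q.2 * (q.1⁻¹ * q.2⁻¹) = q.1⁻¹ := by field_simp
    have e2 : q.2 * (q.1⁻¹ * q.2⁻¹ * (q.1 * q.2)) = q.2 := by field_simp
    rw [e1, e2]
    abel

theorem HasHadamardDerivWithinAt.hasDerivAt {γ : ℝ → F} {γ' : ℝ →ₗ[ℝ] F} {t : ℝ} {S : Set ℝ}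
    (h : HasHadamardDerivWithinAt γ γ' S t) (hS : S ∈ 𝓝 t) : HasDerivAt γ (γ' 1) t := by
  rw [hasDerivAt_iff_tendsto_quotient]
  have h0 : ∀ᶠ s : ℝ in 𝓝[≠] 0, t + s • (1 : ℝ) ∈ S := by
    have : Tendsto (fun s : ℝ => t + s • (1 : ℝ)) (𝓝 0) (𝓝 t) :=
      Continuous.tendsto' (by fun_prop) _ _ (by simp)
    exact (this.eventually hS).filter_mono nhdsWithin_le_nhds
  simpa using h.tendsto_ray le_rfl h0

/-- The derivative of `f` along a curve that stays in the set in which `f` is differentiable. -/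
theorem HasHadamardDerivWithinAt.hasDerivAt_comp {V : Type*} [AddCommGroup V] [Module ℝ V]
    [TopologicalSpace V] [IsTopologicalAddGroup V] [ContinuousSMul ℝ V] {f : V → F}
    {f' : V →ₗ[ℝ] F} {S : Set V} {γ : ℝ → V} {t : ℝ} {v : V}
    (hf : HasHadamardDerivWithinAt f f' S (γ t)) (hγ : HasDerivAt γ v t)
    (hS : ∀ᶠ s in 𝓝 t, γ s ∈ S) : HasDerivAt (fun s => f (γ s)) (f' v) t := by
  have h := (hf.comp (hasHadamardDerivWithinAt_of_hasDerivAt hγ (S := γ ⁻¹' S))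
    (mapsTo_preimage γ S)).hasDerivAt hS
  simpa using h

end Curves

section FiniteDimensional

variable {V : Type*} [NormedAddCommGroup V] [NormedSpace ℝ V]
variable {F : Type*} [NormedAddCommGroup F] [NormedSpace ℝ F]

theorem hasHadamardDerivWithinAt_of_hasFDerivAt {f : V → F} {f' : V →L[ℝ] F} {S : Set V} {x : V}
    (h : HasFDerivAt f f' x) : HasHadamardDerivWithinAt f (f' : V →ₗ[ℝ] F) S x := by
  intro v
  have h2 : Tendsto (fun q : ℝ × V => q.1 • q.2) (quotFilter S x v) (𝓝 0) := by
    simpa using (tendsto_fst_quotFilter.mono_right nhdsWithin_le_nhds).smul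
      (tendsto_snd_quotFilter (S := S) (x := x) (v := v))
  have h1 := (hasFDerivAt_iff_isLittleO_nhds_zero.1 h).comp_tendsto h2
  have h3 : (fun q : ℝ × V => q.1⁻¹ • (f (x + q.1 • q.2) - f x - f' (q.1 • q.2)))
      =o[quotFilter S x v] fun q : ℝ × V => q.1⁻¹ • q.1 • q.2 :=
    (Asymptotics.isBigO_refl (fun q : ℝ × V => q.1⁻¹) _).smul_isLittleO h1
  have h4 : (fun q : ℝ × V => q.1⁻¹ • q.1 • q.2) =O[quotFilter S x v] fun _ => (1 : ℝ) := by
    refine Tendsto.isBigO_one ℝ (c := v) ?_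
    refine tendsto_snd_quotFilter.congr' ?_
    filter_upwards [eventually_quotFilter_ne] with q hq
    rw [inv_smul_smul₀ hq]
  have h5 := ((Asymptotics.isLittleO_one_iff ℝ).1 (h3.trans_isBigO h4)).add
    ((f'.continuous.tendsto v).comp (tendsto_snd_quotFilter (S := S) (x := x) (v := v)))
  rw [zero_add] at h5
  refine h5.congr' ?_
  filter_upwards [eventually_quotFilter_ne] with q hq
  simp [smul_sub, inv_smul_smul₀ hq]

/-- In finite dimensions Hadamard differentiability is Fréchet differentiability: the
convergence of the quotients is uniform on the unit sphere, by compactness. -/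
theorem HasHadamardDerivWithinAt.hasFDerivAt [FiniteDimensional ℝ V] {f : V → F} {f' : V →ₗ[ℝ] F}
    {S : Set V} {x : V} (h : HasHadamardDerivWithinAt f f' S x) (hS : S ∈ 𝓝 x) :
    HasFDerivAt f (LinearMap.toContinuousLinearMap f') x := by
  have : ProperSpace V := FiniteDimensional.proper ℝ V
  have hu : HasHadamardDerivWithinAt f f' univ x :=
    h.mono_of_mem_nhdsWithin (mem_nhdsWithin_of_mem_nhds hS)
  rw [hasFDerivAt_iff_isLittleO_nhds_zero, Asymptotics.isLittleO_iff]
  intro c hc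
  have key : ∀ᶠ t : ℝ in 𝓝 0, ∀ v ∈ Metric.sphere (0 : V) 1,
      t ≠ 0 → ‖t⁻¹ • (f (x + t • v) - f x) - f' v‖ ≤ c := by
    refine (isCompact_sphere (0 : V) 1).eventually_forall_of_forall_eventually fun v _ => ?_
    have h1 : Tendsto (fun q : ℝ × V => q.1⁻¹ • (f (x + q.1 • q.2) - f x) - f' q.2)
        (𝓝[≠] (0 : ℝ) ×ˢ 𝓝 v) (𝓝 0) := by
      have h2 := hu v
      simp only [quotFilter, mem_univ, ofPred_true, principal_univ, inf_top_eq] at h2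
      simpa using h2.sub ((f'.continuous_of_finiteDimensional.tendsto v).comp tendsto_snd)
    have h3 := h1.eventually (Metric.closedBall_mem_nhds _ hc)
    have h4 : (𝓝[≠] (0 : ℝ) ×ˢ 𝓝 v) = 𝓝[{q : ℝ × V | q.1 ≠ 0}] (0, v) := by
      have e : {q : ℝ × V | q.1 ≠ 0} = ({0}ᶜ : Set ℝ) ×ˢ (univ : Set V) := by ext; simp
      rw [e, nhdsWithin_prod_eq, nhdsWithin_univ]
    rw [h4, eventually_nhdsWithin_iff] at h3
    filter_upwards [h3] with q hq hq0
    simpa using hq hq0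
  have hn : Tendsto (fun w : V => ‖w‖) (𝓝 0) (𝓝 0) := tendsto_norm_zero
  filter_upwards [hn.eventually key] with w hw
  rcases eq_or_ne w 0 with rfl | h0
  · simp
  have hw0 : ‖w‖ ≠ 0 := norm_ne_zero_iff.2 h0
  have h1 := hw (‖w‖⁻¹ • w) (by simp [norm_smul, hw0]) hw0
  rw [smul_inv_smul₀ hw0, map_smul, ← smul_sub, norm_smul, norm_inv, norm_norm,
    inv_mul_le_iff₀ (by positivity)] at h1
  simpa [mul_comm] using h1

end FiniteDimensional

theorem HasHadamardDerivWithinAt.bilinear {V : Type*} [AddCommGroup V] [Module ℝ V]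
    [TopologicalSpace V] [ContinuousAdd V] [ContinuousSMul ℝ V] {E : Type*} [AddCommGroup E]
    [Module ℝ E] [TopologicalSpace E] [ContinuousAdd E] [ContinuousSMul ℝ E]
    {ω : E →ₗ[ℝ] E →ₗ[ℝ] ℂ} (hω : Continuous fun p : E × E => ω p.1 p.2) {a b : V → E}
    {a' b' : V →ₗ[ℝ] E} {S : Set V} {x : V} (ha : HasHadamardDerivWithinAt a a' S x)
    (hb : HasHadamardDerivWithinAt b b' S x) :
    HasHadamardDerivWithinAt (fun y => ω (a y) (b y)) (ω.flip (b x) ∘ₗ a' + ω (a x) ∘ₗ b') S x := by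
  intro v
  have hbc : Tendsto (fun q : ℝ × V => b x + q.1 • q.1⁻¹ • (b (x + q.1 • q.2) - b x))
      (quotFilter S x v) (𝓝 (b x)) := by
    simpa using ((tendsto_fst_quotFilter.mono_right nhdsWithin_le_nhds).smul (hb v)).const_add (b x)
  have h1 := (hω.tendsto (a' v, b x)).comp ((ha v).prodMk_nhds hbc)
  have h2 := (hω.tendsto (a x, b' v)).comp (tendsto_const_nhds.prodMk_nhds (hb v))
  have h3 := h1.add h2
  refine h3.congr' ?_
  filter_upwards [eventually_quotFilter_ne] with q hq
  have e : b x + q.1 • q.1⁻¹ • (b (x + q.1 • q.2) - b x) = b (x + q.1 • q.2) := by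
    rw [smul_inv_smul₀ hq]; abel
  simp only [Function.comp_apply, e, map_smul, LinearMap.smul_apply, map_sub, LinearMap.sub_apply,
    ← smul_add]
  congr 1
  abel

/-! ### Maps of class `C^k` are Hadamard differentiable -/

section ConvexBodies

variable {V : Type*} [AddCommGroup V] [Module ℝ V] [TopologicalSpace V]

/-- Every point of `S` has a convex neighbourhood within `S` with nonempty interior. This holds for
open subsets of locally convex spaces, and for relatively open subsets of a convex set with interior
points; on such sets the derivatives in the interior control the map up to the boundary. -/
def IsLocallyConvexBody (S : Set V) : Prop :=
  ∀ x ∈ S, ∃ K ⊆ S, K ∈ 𝓝[S] x ∧ Convex ℝ K ∧ (interior K).Nonempty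

theorem IsLocallyConvexBody.of_isOpen [LocallyConvexSpace ℝ V] {S : Set V} (hS : IsOpen S) :
    IsLocallyConvexBody S := by
  intro x hx
  obtain ⟨K, ⟨hK, hKc⟩, hKS⟩ :=
    (LocallyConvexSpace.convex_basis (𝕜 := ℝ) x).mem_iff.1 (hS.mem_nhds hx)
  exact ⟨K, hKS, mem_nhdsWithin_of_mem_nhds hK, hKc, x, mem_interior_iff_mem_nhds.2 hK⟩

theorem IsLocallyConvexBody.prod_univ {W : Type*} [AddCommGroup W] [Module ℝ W]
    [TopologicalSpace W] {S : Set V} (hS : IsLocallyConvexBody S) :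
    IsLocallyConvexBody (S ×ˢ (univ : Set W)) := by
  rintro ⟨x, w⟩ ⟨hx, -⟩
  obtain ⟨K, hKS, hK, hKc, y, hy⟩ := hS x hx
  refine ⟨K ×ˢ univ, prod_mono_left hKS, ?_, hKc.prod convex_univ, (y, w), ?_⟩
  · rw [nhdsWithin_prod_eq]
    exact prod_mem_prod hK univ_mem
  · rw [interior_prod_eq]
    exact ⟨hy, by simp⟩

variable [IsTopologicalAddGroup V] [ContinuousSMul ℝ V]

theorem _root_.Convex.isLocallyConvexBody_inter {S O : Set V} [LocallyConvexSpace ℝ V]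
    (hS : Convex ℝ S) (hSi : (interior S).Nonempty) (hO : IsOpen O) :
    IsLocallyConvexBody (S ∩ O) := by
  rintro x ⟨hx, hxO⟩
  obtain ⟨K, ⟨hK, hKc⟩, hKO⟩ :=
    (LocallyConvexSpace.convex_basis (𝕜 := ℝ) x).mem_iff.1 (hO.mem_nhds hxO)
  refine ⟨S ∩ K, inter_subset_inter_right _ hKO, inter_mem (mem_of_superset self_mem_nhdsWithin
    inter_subset_left) (mem_nhdsWithin_of_mem_nhds hK), hS.inter hKc, ?_⟩
  have h1 : x ∈ closure (interior S) := by
    rw [hS.closure_interior_eq_closure_of_nonempty_interior hSi]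
    exact subset_closure hx
  rw [interior_inter, inter_comm]
  exact mem_closure_iff_nhds.1 h1 _ (interior_mem_nhds.2 hK)

theorem IsLocallyConvexBody.subset_closure_interior {S : Set V} (hS : IsLocallyConvexBody S) :
    S ⊆ closure (interior S) := by
  intro x hx
  obtain ⟨K, hKS, hK, hKc, hKi⟩ := hS x hx
  have h1 : x ∈ closure (interior K) := by
    rw [hKc.closure_interior_eq_closure_of_nonempty_interior hKi]
    exact subset_closure (mem_of_mem_nhdsWithin hx hK)
  exact closure_mono (interior_mono hKS) h1

end ConvexBodies

section MeanValue

variable {V : Type*} [AddCommGroup V] [Module ℝ V] [TopologicalSpace V] [IsTopologicalAddGroup V]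
  [ContinuousSMul ℝ V]
variable {F : Type*} [AddCommGroup F] [Module ℝ F] [TopologicalSpace F] [IsTopologicalAddGroup F]
  [ContinuousSMul ℝ F]

/-- Mean value theorem on a convex set `K`, with derivatives known only in the interior: a
difference quotient lies in every closed convex set that contains the directional derivatives along
the segment. -/
theorem quotient_mem_of_forall_segment_mem [LocallyConvexSpace ℝ F] {f : V → F} {df : V × V → F}
    {K : Set V} (hK : Convex ℝ K) (hKi : (interior K).Nonempty) (hf : ContinuousOn f K)
    (hd : ∀ x ∈ interior K, ∀ v : V, HasDerivAt (fun t : ℝ => f (x + t • v)) (df (x, v)) 0)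
    (hc : ContinuousOn df (K ×ˢ univ)) {x v : V} {t : ℝ} (hx : x ∈ K) (ht : t ≠ 0)
    (hxt : x + t • v ∈ K) {C : Set F} (hC : Convex ℝ C) (hC' : IsClosed C)
    (hmem : ∀ θ ∈ Icc (0 : ℝ) 1, df (x + (θ * t) • v, v) ∈ C) :
    t⁻¹ • (f (x + t • v) - f x) ∈ C := by
  by_contra hcon
  obtain ⟨l, s, hl, hs⟩ := geometric_hahn_banach_closed_point hC hC' hcon
  obtain ⟨x₀, hx₀⟩ := hKi
  -- Contracting the segment towards the interior point `x₀` moves it into the interior of `K`.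
  set z : ℝ → ℝ → V := fun η θ => (1 - η) • (x + (θ * t) • v) + η • x₀ with hz
  have hseg : ∀ θ ∈ Icc (0 : ℝ) 1, x + (θ * t) • v ∈ K := fun θ hθ => by
    have := hK.add_smul_mem hx hxt hθ
    rwa [smul_smul] at this
  have hzi : ∀ η ∈ Ioo (0 : ℝ) 1, ∀ θ ∈ Icc (0 : ℝ) 1, z η θ ∈ interior K := fun η hη θ hθ =>
    hK.combo_self_interior_mem_interior (hseg θ hθ) hx₀ (by linarith [hη.2]) hη.1 (by ring)
  have hz0 : ∀ θ, z 0 θ = x + (θ * t) • v := fun θ => by simp [hz]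
  have hzc : Continuous fun q : ℝ × ℝ => z q.1 q.2 := by simp only [hz]; fun_prop
  have hsmall : ∀ᶠ η in 𝓝 (0 : ℝ), ∀ θ ∈ Icc (0 : ℝ) 1, z η θ ∈ K → l (df (z η θ, v)) < s := by
    refine isCompact_Icc.eventually_forall_of_forall_eventually fun θ hθ => ?_
    have h1 : df ⁻¹' {y | l y < s} ∈ 𝓝[K ×ˢ univ] (z 0 θ, v) := by
      refine hc _ ⟨by rw [hz0]; exact hseg θ hθ, mem_univ _⟩ ?_
      refine (isOpen_Iio.preimage l.continuous).mem_nhds ?_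
      rw [hz0]
      exact hl _ (hmem θ hθ)
    have h2 : Tendsto (fun q : ℝ × ℝ => (z q.1 q.2, v)) (𝓝 (0, θ)) (𝓝 (z 0 θ, v)) :=
      (hzc.prodMk continuous_const).tendsto (0, θ)
    have h3 := h2.eventually (mem_nhdsWithin_iff_eventually.1 h1)
    filter_upwards [h3] with q hq hqK
    exact hq ⟨hqK, mem_univ _⟩
  have hslope : ∀ η ∈ Ioo (0 : ℝ) 1, ∃ θ ∈ Ioo (0 : ℝ) 1,
      ((1 - η) * t) * l (df (z η θ, v)) = l (f (z η 1)) - l (f (z η 0)) := by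
    intro η hη
    have hmove : ∀ θ τ : ℝ, z η (θ + τ) = z η θ + ((1 - η) * t * τ) • v := fun θ τ => by
      simp only [hz]; module
    have hder : ∀ θ ∈ Icc (0 : ℝ) 1,
        HasDerivAt (fun θ => l (f (z η θ))) ((1 - η) * t * l (df (z η θ, v))) θ := by
      intro θ hθ
      have h0 := hasDerivAt_iff_tendsto_quotient.1 (hd _ (hzi η hη θ hθ) v)
      rw [hasDerivAt_iff_tendsto_quotient]
      have hne : (1 - η) * t ≠ 0 := mul_ne_zero (by linarith [hη.2]) ht
      have h1 : Tendsto (fun τ : ℝ => (1 - η) * t * τ) (𝓝[≠] 0) (𝓝[≠] 0) := by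
        refine tendsto_nhdsWithin_iff.2 ⟨?_, ?_⟩
        · exact (Continuous.tendsto' (by fun_prop) _ _ (by simp)).mono_left nhdsWithin_le_nhds
        · filter_upwards [eventually_mem_nhdsWithin] with τ hτ
          exact mul_ne_zero hne hτ
      have h2 := ((l.continuous.tendsto _).comp (h0.comp h1)).const_mul ((1 - η) * t)
      refine h2.congr' ?_
      filter_upwards [eventually_mem_nhdsWithin] with τ hτ
      have hτ' : τ ≠ 0 := hτ
      simp only [Function.comp_apply, hmove, zero_add, map_smul, map_sub, smul_eq_mul, zero_smul,
        add_zero]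
      generalize 1 - η = a at *
      have ha : a ≠ 0 := left_ne_zero_of_mul hne
      field_simp
    obtain ⟨θ, hθ, h⟩ := exists_hasDerivAt_eq_slope (fun θ => l (f (z η θ)))
      (fun θ => (1 - η) * t * l (df (z η θ, v))) zero_lt_one
      (fun θ hθ => (hder θ hθ).continuousAt.continuousWithinAt)
      (fun θ hθ => hder θ (Ioo_subset_Icc_self hθ))
    refine ⟨θ, hθ, ?_⟩
    simpa using h
  have hlim : Tendsto (fun η : ℝ => ((1 - η) * t)⁻¹ * (l (f (z η 1)) - l (f (z η 0))))
      (𝓝[>] 0) (𝓝 (t⁻¹ * (l (f (x + t • v)) - l (f x)))) := by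
    have hf' : ∀ θ ∈ Icc (0 : ℝ) 1, Tendsto (fun η => l (f (z η θ))) (𝓝[>] 0)
        (𝓝 (l (f (x + (θ * t) • v)))) := by
      intro θ hθ
      refine (l.continuous.tendsto _).comp ?_
      refine ((hf _ (hseg θ hθ)).tendsto).comp (tendsto_nhdsWithin_iff.2 ⟨?_, ?_⟩)
      · have : Continuous fun η => z η θ := hzc.comp (Continuous.prodMk_left θ)
        exact (this.tendsto' 0 _ (hz0 θ)).mono_left nhdsWithin_le_nhds
      · filter_upwards [Ioo_mem_nhdsGT (zero_lt_one' ℝ)] with η hη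
        exact interior_subset (hzi η hη θ hθ)
    have h1 := hf' 1 (by simp)
    have h0 := hf' 0 (by simp)
    simp only [one_mul, zero_mul, zero_smul, add_zero] at h1 h0
    refine Tendsto.mul ?_ (h1.sub h0)
    have : ContinuousAt (fun η : ℝ => ((1 - η) * t)⁻¹) 0 :=
      ContinuousAt.inv₀ (by fun_prop) (by simpa using ht)
    simpa using this.tendsto.mono_left nhdsWithin_le_nhds
  have hle : t⁻¹ * (l (f (x + t • v)) - l (f x)) ≤ s := by
    refine le_of_tendsto hlim ?_
    filter_upwards [Ioo_mem_nhdsGT (zero_lt_one' ℝ), hsmall.filter_mono nhdsWithin_le_nhds]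
      with η hη hη'
    obtain ⟨θ, hθ, h⟩ := hslope η hη
    have hne : (1 - η) * t ≠ 0 := mul_ne_zero (by linarith [hη.2]) ht
    rw [← h, inv_mul_cancel_left₀ hne]
    exact (hη' θ (Ioo_subset_Icc_self hθ)
      (interior_subset (hzi η hη θ (Ioo_subset_Icc_self hθ)))).le
  rw [map_smul, map_sub, smul_eq_mul] at hs
  linarith

variable {f : V → F} {df : V × V → F} {S : Set V}

/-- The difference quotients of a `C^1` map converge, also when the base point varies. -/
theorem tendsto_quotient_of_C1 [LocallyConvexSpace ℝ F] (hS : IsLocallyConvexBody S) (hf : ContinuousOn f S)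
    (hd : ∀ x ∈ interior S, ∀ v : V, HasDerivAt (fun t : ℝ => f (x + t • v)) (df (x, v)) 0)
    (hc : ContinuousOn df (S ×ˢ univ)) {x : V} (hx : x ∈ S) (v : V) :
    Tendsto (fun p : V × ℝ × V => p.2.1⁻¹ • (f (p.1 + p.2.1 • p.2.2) - f p.1))
      ((𝓝 x ×ˢ (𝓝[≠] (0 : ℝ) ×ˢ 𝓝 v)) ⊓ 𝓟 {p | p.1 ∈ S ∧ p.1 + p.2.1 • p.2.2 ∈ S})
      (𝓝 (df (x, v))) := by
  intro U hU
  obtain ⟨U₁, ⟨hU₁, hU₁c⟩, hU₁U⟩ := (closed_nhds_basis (df (x, v))).mem_iff.1 hU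
  obtain ⟨U₂, ⟨hU₂, hU₂c⟩, hU₂U⟩ :=
    (LocallyConvexSpace.convex_basis (𝕜 := ℝ) (df (x, v))).mem_iff.1 hU₁
  have hCsub : closure U₂ ⊆ U := (closure_minimal hU₂U hU₁c).trans hU₁U
  obtain ⟨K, hKS, hK, hKc, hKi⟩ := hS x hx
  have hKi' : interior K ⊆ interior S := interior_mono hKS
  have hfK := hf.mono hKS
  have hcK : ContinuousOn df (K ×ˢ univ) := hc.mono (prod_mono_left hKS)
  have hxK := mem_of_mem_nhdsWithin hx hK
  have h1 : ∀ᶠ p : V × V in 𝓝 (x, v), p ∈ K ×ˢ (univ : Set V) → df p ∈ closure U₂ :=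
    mem_nhdsWithin_iff_eventually.1
      (hcK (x, v) ⟨hxK, mem_univ _⟩ (mem_of_superset hU₂ subset_closure))
  have h2 : ∀ᶠ p : V × ℝ × V in 𝓝 (x, 0, v), ∀ θ ∈ Icc (0 : ℝ) 1,
      (p.1 + (θ * p.2.1) • p.2.2, p.2.2) ∈ K ×ˢ (univ : Set V) →
      df (p.1 + (θ * p.2.1) • p.2.2, p.2.2) ∈ closure U₂ := by
    refine isCompact_Icc.eventually_forall_of_forall_eventually fun θ _ => ?_
    have hcont : Continuous fun q : (V × ℝ × V) × ℝ =>
        (q.1.1 + (q.2 * q.1.2.1) • q.1.2.2, q.1.2.2) := by fun_prop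
    exact (hcont.tendsto' ((x, 0, v), θ) (x, v) (by simp)).eventually h1
  have h3 : ∀ᶠ y in 𝓝 x, y ∈ S → y ∈ K := mem_nhdsWithin_iff_eventually.1 hK
  have h4 : ∀ᶠ p : V × ℝ × V in 𝓝 (x, 0, v), (p.1 ∈ S → p.1 ∈ K) ∧
      (p.1 + p.2.1 • p.2.2 ∈ S → p.1 + p.2.1 • p.2.2 ∈ K) := by
    refine Eventually.and ?_ ?_
    · exact (continuous_fst.tendsto (x, (0 : ℝ), v)).eventually h3
    · have hcont : Continuous fun p : V × ℝ × V => p.1 + p.2.1 • p.2.2 := by fun_prop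
      exact (hcont.tendsto' (x, 0, v) x (by simp)).eventually h3
  have hle : 𝓝 x ×ˢ (𝓝[≠] (0 : ℝ) ×ˢ 𝓝 v) ≤ 𝓝 (x, 0, v) := by
    rw [nhds_prod_eq, nhds_prod_eq]
    exact Filter.prod_mono le_rfl (Filter.prod_mono nhdsWithin_le_nhds le_rfl)
  have hne : ∀ᶠ p : V × ℝ × V in 𝓝 x ×ˢ (𝓝[≠] (0 : ℝ) ×ˢ 𝓝 v), p.2.1 ≠ 0 :=
    ((eventually_mem_nhdsWithin (a := (0 : ℝ)) (s := {0}ᶜ)).prod_inl _).prod_inr _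
  rw [mem_map, mem_inf_principal]
  filter_upwards [hle h2, hle h4, hne] with p hp2 hp4 hp0 hpS
  have hpK := hp4.1 hpS.1
  have hpK' := hp4.2 hpS.2
  refine hCsub (quotient_mem_of_forall_segment_mem hKc hKi hfK (fun y hy => hd y (hKi' hy)) hcK hpK
    hp0 hpK' hU₂c.closure isClosed_closure fun θ hθ => hp2 θ hθ ⟨?_, mem_univ _⟩)
  have := hKc.add_smul_mem hpK hpK' hθ
  rwa [smul_smul] at this

variable [T2Space F]

theorem directionalDeriv_add_of_C1 [LocallyConvexSpace ℝ F]
    (hS : IsLocallyConvexBody S) (hf : ContinuousOn f S)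
    (hd : ∀ x ∈ interior S, ∀ v : V, HasDerivAt (fun t : ℝ => f (x + t • v)) (df (x, v)) 0)
    (hc : ContinuousOn df (S ×ˢ univ)) {x : V} (hx : x ∈ S) (v w : V) :
    df (x, v + w) = df (x, v) + df (x, w) := by
  -- By density of the interior and continuity, interior points suffice.
  have hcv : ∀ u : V, ContinuousOn (fun y => df (y, u)) S := fun u =>
    hc.comp (by fun_prop) fun y hy => ⟨hy, mem_univ _⟩
  refine EqOn.of_subset_closure (s := interior S) (fun y hy => ?_) (hcv (v + w))
    ((hcv v).add (hcv w)) interior_subset hS.subset_closure_interior hx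
  have hyS := interior_subset hy
  have hmem : ∀ u : V, ∀ᶠ t : ℝ in 𝓝[≠] 0, y + t • u ∈ S := fun u => by
    have : Tendsto (fun t : ℝ => y + t • u) (𝓝 0) (𝓝 y) :=
      Continuous.tendsto' (by fun_prop) _ _ (by simp)
    exact (this.eventually (mem_interior_iff_mem_nhds.1 hy)).filter_mono nhdsWithin_le_nhds
  have ht : ∀ b : ℝ → V, Tendsto b (𝓝[≠] 0) (𝓝 y) → ∀ u, (∀ᶠ t : ℝ in 𝓝[≠] 0, b t ∈ S) →
      (∀ᶠ t : ℝ in 𝓝[≠] 0, b t + t • u ∈ S) →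
      Tendsto (fun t : ℝ => t⁻¹ • (f (b t + t • u) - f (b t))) (𝓝[≠] 0) (𝓝 (df (y, u))) := by
    intro b hb u h1 h2
    refine (tendsto_quotient_of_C1 hS hf hd hc hyS u).comp
      (f := fun t : ℝ => (b t, t, u)) (tendsto_inf.2 ⟨?_, tendsto_principal.2 (h1.and h2)⟩)
    exact hb.prodMk (tendsto_id.prodMk tendsto_const_nhds)
  have hbv : Tendsto (fun t : ℝ => y + t • v) (𝓝[≠] 0) (𝓝 y) :=
    (Continuous.tendsto' (by fun_prop) _ _ (by simp)).mono_left nhdsWithin_le_nhds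
  have hassoc : ∀ t : ℝ, y + t • v + t • w = y + t • (v + w) := fun t => by
    rw [smul_add, add_assoc]
  have h1 := ht _ hbv w (hmem v) (by simpa only [hassoc] using hmem (v + w))
  have h2 := ht (fun _ => y) tendsto_const_nhds v (Eventually.of_forall fun _ => hyS) (hmem v)
  have h3 := ht (fun _ => y) tendsto_const_nhds (v + w) (Eventually.of_forall fun _ => hyS)
    (hmem (v + w))
  refine tendsto_nhds_unique h3 ((h2.add h1).congr fun t => ?_)
  rw [← smul_add, hassoc]
  congr 1
  abel

theorem directionalDeriv_smul_of_C1 (hS : IsLocallyConvexBody S)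
    (hd : ∀ x ∈ interior S, ∀ v : V, HasDerivAt (fun t : ℝ => f (x + t • v)) (df (x, v)) 0)
    (hc : ContinuousOn df (S ×ˢ univ)) {x : V} (hx : x ∈ S) (c : ℝ) (v : V) :
    df (x, c • v) = c • df (x, v) := by
  have hcv : ∀ u : V, ContinuousOn (fun y => df (y, u)) S := fun u =>
    hc.comp (by fun_prop) fun y hy => ⟨hy, mem_univ _⟩
  refine EqOn.of_subset_closure (s := interior S) (fun y hy => ?_) (hcv (c • v))
    ((hcv v).const_smul c) interior_subset hS.subset_closure_interior hx
  have h1 := hasDerivAt_iff_tendsto_quotient.1 (hd y hy (c • v))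
  have h2 := hasDerivAt_iff_tendsto_quotient.1 (hd y hy v)
  simp only [zero_add, zero_smul, add_zero] at h1 h2
  rcases eq_or_ne c 0 with rfl | hc0
  · simp only [zero_smul, smul_zero, add_zero, sub_self] at h1 ⊢
    exact tendsto_nhds_unique h1 tendsto_const_nhds
  have h3 : Tendsto (fun t : ℝ => t * c) (𝓝[≠] 0) (𝓝[≠] 0) := by
    refine tendsto_nhdsWithin_iff.2 ⟨?_, ?_⟩
    · exact (Continuous.tendsto' (by fun_prop) _ _ (by simp)).mono_left nhdsWithin_le_nhds
    · filter_upwards [eventually_mem_nhdsWithin] with t ht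
      exact mul_ne_zero ht hc0
  refine tendsto_nhds_unique h1 (((h2.comp h3).const_smul c).congr fun t => ?_)
  simp only [Function.comp_apply, smul_smul]
  congr 1
  field_simp

end MeanValue

section Ck

universe u v

variable {V : Type u} [AddCommGroup V] [Module ℝ V] [TopologicalSpace V]
variable {F : Type v} [AddCommGroup F] [Module ℝ F] [TopologicalSpace F] [ContinuousSMul ℝ F]
variable {f g : V → F} {S : Set V}

theorem CkOn.congr [ContinuousAdd V] [ContinuousSMul ℝ V] [IsTopologicalAddGroup F] {k : ℕ}
    (hf : CkOn k f S) (h : EqOn g f S) : CkOn k g S := by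
  cases k with
  | zero => exact ContinuousOn.congr hf h
  | succ k =>
    obtain ⟨hf0, df, hd, hk⟩ := hf
    refine ⟨hf0.congr h, df, fun x hx v => ?_, hk⟩
    have h1 := hasDerivAt_iff_tendsto_quotient.1 (hd x hx v)
    refine hasDerivAt_iff_tendsto_quotient.2 (h1.congr' ?_)
    have h2 : Tendsto (fun t : ℝ => x + (0 + t) • v) (𝓝 0) (𝓝 x) :=
      Continuous.tendsto' (by fun_prop) _ _ (by simp)
    filter_upwards [(h2.eventually (mem_interior_iff_mem_nhds.1 hx)).filter_mono nhdsWithin_le_nhds]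
      with t ht
    rw [h ht, h (by simpa using interior_subset hx)]

theorem CkOn.continuousOn {k : ℕ} (hf : CkOn k f S) : ContinuousOn f S := by
  cases k with
  | zero => exact hf
  | succ k => exact hf.1

variable [IsTopologicalAddGroup V] [ContinuousSMul ℝ V] [IsTopologicalAddGroup F]
  [LocallyConvexSpace ℝ F] [T2Space F]

/-- A map of class `C^(k+1)` is Hadamard differentiable, and its derivative is of class `C^k`. -/
theorem CkOn.exists_hasHadamardDerivWithinAt {k : ℕ} (hf : CkOn (k + 1) f S)
    (hS : IsLocallyConvexBody S) :
    ∃ D : V → V →ₗ[ℝ] F, (∀ x ∈ S, HasHadamardDerivWithinAt f (D x) S x) ∧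
      CkOn k (fun p : V × V => D p.1 p.2) (S ×ˢ univ) := by
  classical
  obtain ⟨hf0, df, hd, hk⟩ := hf
  have hc := hk.continuousOn
  set D : V → V →ₗ[ℝ] F := fun x =>
    if hx : x ∈ S then
      { toFun := fun v => df (x, v)
        map_add' := directionalDeriv_add_of_C1 hS hf0 hd hc hx
        map_smul' := directionalDeriv_smul_of_C1 hS hd hc hx }
    else 0 with hD
  have hDx : ∀ x ∈ S, ∀ v, D x v = df (x, v) := fun x hx v => by simp [hD, hx]
  refine ⟨D, fun x hx v => ?_, hk.congr fun p hp => hDx _ hp.1 _⟩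
  rw [hDx x hx]
  refine (tendsto_quotient_of_C1 hS hf0 hd hc hx v).comp (f := fun q : ℝ × V => (x, q))
    (tendsto_inf.2 ⟨?_, tendsto_principal.2 ?_⟩)
  · exact tendsto_const_nhds.prodMk (tendsto_id.mono_left inf_le_left)
  · filter_upwards [eventually_quotFilter_mem] with q hq
    exact ⟨hx, hq⟩

end Ck

/-! ### The Maurer–Cartan form along a smooth map -/

section Twice

universe u v

variable {V : Type u} [AddCommGroup V] [Module ℝ V] [TopologicalSpace V]
variable {F : Type v} [AddCommGroup F] [Module ℝ F] [TopologicalSpace F]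

/-- `D` is a continuous Hadamard derivative of `f` on `S`, and as a function of the point and the
direction it is Hadamard differentiable in its turn. -/
structure IsSmoothDerivOn (f : V → F) (D : V → V →ₗ[ℝ] F) (S : Set V) : Prop where
  hasDeriv : ∀ x ∈ S, HasHadamardDerivWithinAt f (D x) S x
  continuousOn : ContinuousOn (fun p : V × V => D p.1 p.2) (S ×ˢ univ)
  exists_second : ∀ x ∈ S, ∀ v, ∃ D' : V × V →ₗ[ℝ] F,
    HasHadamardDerivWithinAt (fun p : V × V => D p.1 p.2) D' (S ×ˢ univ) (x, v)

theorem SmoothOn.exists_isSmoothDerivOn [IsTopologicalAddGroup V] [ContinuousSMul ℝ V]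
    [IsTopologicalAddGroup F] [ContinuousSMul ℝ F] [LocallyConvexSpace ℝ F] [T2Space F] {f : V → F}
    {S : Set V} (hf : SmoothOn f S) (hS : IsLocallyConvexBody S) :
    ∃ D : V → V →ₗ[ℝ] F, IsSmoothDerivOn f D S := by
  obtain ⟨D, hD, hD1⟩ := (hf 2).exists_hasHadamardDerivWithinAt hS
  obtain ⟨D2, hD2, -⟩ := hD1.exists_hasHadamardDerivWithinAt (k := 0) hS.prod_univ
  exact ⟨D, hD, hD1.continuousOn, fun x hx v => ⟨D2 (x, v), hD2 _ ⟨hx, mem_univ _⟩⟩⟩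

end Twice

theorem deriv_eq_of_hasDerivAt {F : Type*} [AddCommGroup F] [Module ℝ F] [TopologicalSpace F]
    [IsTopologicalAddGroup F] [ContinuousSMul ℝ F] [T2Space F] {γ : ℝ → F} {v : F} {t : ℝ}
    (h : HasDerivAt γ v t) : deriv γ t = v := by
  have h1 := DifferentiableAt.hasFDerivAt ⟨_, h.hasFDerivAt⟩
  have h2 := congrArg (fun l => l 1) (h1.unique h.hasFDerivAt)
  simpa [deriv] using h2

section LieGroup

variable {E : Type*} [AddCommGroup E] [Module ℝ E] [TopologicalSpace E] [ContinuousSMul ℝ E]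
variable {L : Type*} [TopologicalSpace L] [ChartedSpace E L] [Group L] [IsLieGroup E L]

theorem isOpen_chartMul_domain (e₁ e₂ e₃ : OpenPartialHomeomorph L E) :
    IsOpen {p : E × E | p.1 ∈ e₁.target ∧ p.2 ∈ e₂.target ∧
      e₁.symm p.1 * e₂.symm p.2 ∈ e₃.source} := by
  have := IsLieGroup.toIsTopologicalGroup E (L := L)
  have hc : ContinuousOn (fun p : E × E => e₁.symm p.1 * e₂.symm p.2) (e₁.target ×ˢ e₂.target) :=
    (e₁.continuousOn_symm.comp continuousOn_fst fun p hp => hp.1).mul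
      (e₂.continuousOn_symm.comp continuousOn_snd fun p hp => hp.2)
  convert hc.isOpen_inter_preimage (e₁.open_target.prod e₂.open_target) e₃.open_source using 1
  ext p
  simp [and_assoc]

theorem isOpen_chartInv_domain (e₁ e₂ : OpenPartialHomeomorph L E) :
    IsOpen {x : E | x ∈ e₁.target ∧ (e₁.symm x)⁻¹ ∈ e₂.source} := by
  have := IsLieGroup.toIsTopologicalGroup E (L := L)
  exact e₁.continuousOn_symm.inv.isOpen_inter_preimage e₁.open_target e₂.open_source

variable [IsTopologicalAddGroup E] [LocallyConvexSpace ℝ E] [T2Space E]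

theorem exists_isSmoothDerivOn_chartMul (g₁ g₂ g₃ : L) :
    ∃ D : E × E → E × E →ₗ[ℝ] E, IsSmoothDerivOn
      (fun p : E × E =>
        chartAt E g₃ ((chartAt E g₁).symm p.1 * (chartAt E g₂).symm p.2)) D
      {p | p.1 ∈ (chartAt E g₁).target ∧ p.2 ∈ (chartAt E g₂).target ∧
        (chartAt E g₁).symm p.1 * (chartAt E g₂).symm p.2 ∈ (chartAt E g₃).source} :=
  (IsLieGroup.smooth_mul _ (chart_mem_atlas E g₁) _ (chart_mem_atlas E g₂) _
    (chart_mem_atlas E g₃)).exists_isSmoothDerivOn (.of_isOpen (isOpen_chartMul_domain _ _ _))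

theorem exists_isSmoothDerivOn_chartInv (g₁ g₂ : L) :
    ∃ D : E → E →ₗ[ℝ] E, IsSmoothDerivOn
      (fun x : E => chartAt E g₂ ((chartAt E g₁).symm x)⁻¹) D
      {x | x ∈ (chartAt E g₁).target ∧ ((chartAt E g₁).symm x)⁻¹ ∈ (chartAt E g₂).source} :=
  (IsLieGroup.smooth_inv _ (chart_mem_atlas E g₁) _
    (chart_mem_atlas E g₂)).exists_isSmoothDerivOn (.of_isOpen (isOpen_chartInv_domain _ _))

section Form

variable {V : Type*} [AddCommGroup V] [Module ℝ V] [TopologicalSpace V] [IsTopologicalAddGroup V]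
  [ContinuousSMul ℝ V]

/-- `A` is the pullback under `h`, defined on `S`, of the left Maurer–Cartan form: `A p v` is the
derivative at `p` in the direction `v` of the left translate `q ↦ h(p)⁻¹ h(q)`, read in the
preferred chart at the identity; `A` is continuous, and Hadamard differentiable in the point and
the direction jointly. -/
structure IsMaurerCartanOn (h : V → L) (A : V → V →ₗ[ℝ] E) (S : Set V) : Prop where
  hasDeriv : ∀ p ∈ S,
    HasHadamardDerivWithinAt (fun q => chartAt E (1 : L) ((h p)⁻¹ * h q)) (A p) S p
  continuousOn : ContinuousOn (fun p : V × V => A p.1 p.2) (S ×ˢ univ)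
  exists_second : ∀ p ∈ S, ∀ v, ∃ D : V × V →ₗ[ℝ] E,
    HasHadamardDerivWithinAt (fun p : V × V => A p.1 p.2) D (S ×ˢ univ) (p, v)

/-- In a chart `ψ` around `h(p₀)`, with `u = ψ ∘ h`, the translate `h(p)⁻¹ h(q)` is the product, read
in charts, of the inverse of `u(p)` and of `u(q)`, so its derivative in `q` is the partial derivative
of the product in the second variable, applied to the derivative of `u`. -/
theorem exists_isMaurerCartanOn_local [LocallyConvexSpace ℝ V] {h : V → L} {S : Set V}
    (hh : SmoothMapOn E h S) (hS : Convex ℝ S) (hSi : (interior S).Nonempty) {p₀ : V}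
    (hp₀ : p₀ ∈ S) :
    ∃ O : Set V, IsOpen O ∧ p₀ ∈ O ∧ ∃ a : V → V →ₗ[ℝ] E, IsMaurerCartanOn h a (S ∩ O) := by
  have := IsLieGroup.toIsTopologicalGroup E (L := L)
  obtain ⟨hc, hcharts⟩ := hh
  set g₀ := h p₀
  have hψ := hcharts _ (chart_mem_atlas E g₀)
  -- `h` is only continuous on `S`, so the chart domains pull back to relatively open sets `S ∩ O`.
  obtain ⟨O₁, hO₁, hSO₁⟩ := continuousOn_iff'.1 hc _ (chartAt E g₀).open_source
  obtain ⟨O₂, hO₂, hSO₂⟩ := continuousOn_iff'.1 hc.inv _ (chartAt E g₀⁻¹).open_source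
  rw [inter_comm, hSO₁, inter_comm] at hψ
  obtain ⟨Du, hDu⟩ := hψ.exists_isSmoothDerivOn (hS.isLocallyConvexBody_inter hSi hO₁)
  obtain ⟨Dm, hDm⟩ := exists_isSmoothDerivOn_chartMul (E := E) g₀⁻¹ g₀ (1 : L)
  obtain ⟨Di, hDi⟩ := exists_isSmoothDerivOn_chartInv (E := E) g₀ g₀⁻¹
  set u : V → E := fun p => chartAt E g₀ (h p)
  set i : E → E := fun x => chartAt E g₀⁻¹ ((chartAt E g₀).symm x)⁻¹
  have hsrc : ∀ p ∈ S ∩ (O₁ ∩ O₂), h p ∈ (chartAt E g₀).source ∧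
      (h p)⁻¹ ∈ (chartAt E g₀⁻¹).source := fun p hp =>
    ⟨(hSO₁.symm.subset ⟨hp.2.1, hp.1⟩).1, (hSO₂.symm.subset ⟨hp.2.2, hp.1⟩).1⟩
  have hsymm : ∀ p ∈ S ∩ (O₁ ∩ O₂), (chartAt E g₀).symm (u p) = h p := fun p hp =>
    (chartAt E g₀).left_inv (hsrc p hp).1
  have hui : ∀ p ∈ S ∩ (O₁ ∩ O₂), u p ∈ {x | x ∈ (chartAt E g₀).target ∧
      ((chartAt E g₀).symm x)⁻¹ ∈ (chartAt E g₀⁻¹).source} := fun p hp =>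
    ⟨(chartAt E g₀).map_source (hsrc p hp).1, by rw [hsymm p hp]; exact (hsrc p hp).2⟩
  have hisymm : ∀ p ∈ S ∩ (O₁ ∩ O₂), (chartAt E g₀⁻¹).symm (i (u p)) = (h p)⁻¹ := fun p hp => by
    simp only [i, hsymm p hp]
    exact (chartAt E g₀⁻¹).left_inv (hsrc p hp).2
  have him : ∀ p ∈ S ∩ (O₁ ∩ O₂), (i (u p), u p) ∈ {p : E × E | p.1 ∈ (chartAt E g₀⁻¹).target ∧
      p.2 ∈ (chartAt E g₀).target ∧ (chartAt E g₀⁻¹).symm p.1 * (chartAt E g₀).symm p.2 ∈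
        (chartAt E (1 : L)).source} := fun p hp => by
    refine ⟨(chartAt E g₀⁻¹).map_source (hui p hp).2, (hui p hp).1, ?_⟩
    simp only [hsymm p hp, hisymm p hp, inv_mul_cancel]
    exact mem_chart_source E 1
  have hDu' : ∀ p ∈ S ∩ (O₁ ∩ O₂), HasHadamardDerivWithinAt u (Du p) (S ∩ (O₁ ∩ O₂)) p :=
    fun p hp => (hDu.hasDeriv p ⟨hp.1, hp.2.1⟩).mono (inter_subset_inter_right _ inter_subset_left)
  have huc : ContinuousOn u (S ∩ (O₁ ∩ O₂)) :=
    (chartAt E g₀).continuousOn.comp (hc.mono inter_subset_left) fun p hp => (hsrc p hp).1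
  have hiuc : ContinuousOn (fun p => i (u p)) (S ∩ (O₁ ∩ O₂)) := by
    have h1 : ContinuousOn (fun p => chartAt E g₀⁻¹ (h p)⁻¹) (S ∩ (O₁ ∩ O₂)) :=
      (chartAt E g₀⁻¹).continuousOn.comp (hc.inv.mono inter_subset_left) fun p hp => (hsrc p hp).2
    exact h1.congr fun p hp => by simp only [i, hsymm p hp]
  have hsub : (S ∩ (O₁ ∩ O₂)) ×ˢ (univ : Set V) ⊆ (S ∩ O₁) ×ˢ univ :=
    prod_mono_left (inter_subset_inter_right _ inter_subset_left)
  have hfst : ∀ x : V × V, HasHadamardDerivWithinAt (Prod.fst : V × V → V) (LinearMap.fst ℝ V V)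
      ((S ∩ (O₁ ∩ O₂)) ×ˢ univ) x := fun x =>
    hasHadamardDerivWithinAt_linear (LinearMap.fst ℝ V V) continuous_fst
  refine ⟨O₁ ∩ O₂, hO₁.inter hO₂, ⟨?_, ?_⟩,
    fun p => Dm (i (u p), u p) ∘ₗ (LinearMap.prod 0 (Du p)), ?_, ?_, ?_⟩
  · exact (hSO₁.subset ⟨mem_chart_source E g₀, hp₀⟩).1
  · exact (hSO₂.subset ⟨mem_chart_source E g₀⁻¹, hp₀⟩).1
  · intro p hp
    -- The domain of `q ↦ (i (u p), u q)` is cut down so that it maps into the domain of the product.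
    set Ω := {p : E × E | p.1 ∈ (chartAt E g₀⁻¹).target ∧
      p.2 ∈ (chartAt E g₀).target ∧ (chartAt E g₀⁻¹).symm p.1 * (chartAt E g₀).symm p.2 ∈
        (chartAt E (1 : L)).source}
    have hΩ : IsOpen Ω := isOpen_chartMul_domain _ _ _
    have hN : {q | (i (u p), u q) ∈ Ω} ∈ 𝓝[S ∩ (O₁ ∩ O₂)] p :=
      (continuousWithinAt_const.prodMk (huc p hp)) (hΩ.mem_nhds (him p hp))
    have h1 := (hDm.hasDeriv _ (him p hp)).comp
      (f := fun q => (i (u p), u q)) (S := {q | (i (u p), u q) ∈ Ω} ∩ (S ∩ (O₁ ∩ O₂)))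
      (((hasHadamardDerivWithinAt_const _).prodMk (hDu' p hp)).mono inter_subset_right)
      fun q hq => hq.1
    have h2 := h1.mono_of_mem_nhdsWithin (inter_mem hN self_mem_nhdsWithin)
    refine h2.congr ?_ ?_
    · filter_upwards [self_mem_nhdsWithin] with q hq
      simp only [hisymm p hp, hsymm q hq]
    · simp only [hisymm p hp, hsymm p hp]
  · refine hDm.continuousOn.comp (f := fun x : V × V => ((i (u x.1), u x.1), ((0 : E), Du x.1 x.2)))
      ?_ fun x hx => ⟨him _ hx.1, mem_univ _⟩
    have h1 : MapsTo (Prod.fst : V × V → V) ((S ∩ (O₁ ∩ O₂)) ×ˢ univ) (S ∩ (O₁ ∩ O₂)) :=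
      fun x hx => hx.1
    exact ((hiuc.comp continuousOn_fst h1).prodMk (huc.comp continuousOn_fst h1)).prodMk
      (continuousOn_const.prodMk (hDu.continuousOn.mono hsub))
  · intro p hp v
    obtain ⟨Dm2, hDm2⟩ := hDm.exists_second _ (him p hp) (0, Du p v)
    obtain ⟨Du2, hDu2⟩ := hDu.exists_second p ⟨hp.1, hp.2.1⟩ v
    have hu1 := HasHadamardDerivWithinAt.comp (x := (p, v)) (f := (Prod.fst : V × V → V))
      (hDu' p hp) (hfst (p, v)) fun x hx => hx.1
    have hi1 := HasHadamardDerivWithinAt.comp (x := (p, v)) (f := fun x : V × V => u x.1)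
      (hDi.hasDeriv _ (hui p hp)) hu1 fun x hx => hui _ hx.1
    have hpair := (hi1.prodMk hu1).prodMk
      ((hasHadamardDerivWithinAt_const (0 : E)).prodMk (hDu2.mono hsub))
    have h1 := HasHadamardDerivWithinAt.comp (S := (S ∩ (O₁ ∩ O₂)) ×ˢ univ) (x := (p, v))
      (f := fun x : V × V => ((i (u x.1), u x.1), ((0 : E), Du x.1 x.2)))
      hDm2 hpair fun x hx => ⟨him _ hx.1, mem_univ _⟩
    exact ⟨_, h1⟩

theorem exists_isMaurerCartanOn [LocallyConvexSpace ℝ V] {h : V → L} {S : Set V}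
    (hh : SmoothMapOn E h S) (hS : Convex ℝ S) (hSi : (interior S).Nonempty) :
    ∃ A : V → V →ₗ[ℝ] E, IsMaurerCartanOn h A S := by
  classical
  have hloc := fun p (hp : p ∈ S) => exists_isMaurerCartanOn_local hh hS hSi hp
  choose! O hO hpO a ha using hloc
  have hmem : ∀ p ∈ S, S ∩ O p ∈ 𝓝[S] p := fun p hp =>
    inter_mem self_mem_nhdsWithin (mem_nhdsWithin_of_mem_nhds ((hO p hp).mem_nhds (hpO p hp)))
  have hder : ∀ p₀ ∈ S, ∀ p ∈ S ∩ O p₀,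
      HasHadamardDerivWithinAt (fun q => chartAt E (1 : L) ((h p)⁻¹ * h q)) (a p₀ p) S p :=
    fun p₀ hp₀ p hp => ((ha p₀ hp₀).hasDeriv p hp).mono_of_mem_nhdsWithin
      (inter_mem self_mem_nhdsWithin (mem_nhdsWithin_of_mem_nhds ((hO p₀ hp₀).mem_nhds hp.2)))
  have heq : ∀ p₀ ∈ S, ∀ p ∈ S ∩ O p₀, a p p = a p₀ p := fun p₀ hp₀ p hp =>
    (hder p hp.1 p ⟨hp.1, hpO p hp.1⟩).unique (hder p₀ hp₀ p hp) hS hSi hp.1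
  have hmem2 : ∀ p ∈ S, ∀ v : V, (S ∩ O p) ×ˢ (univ : Set V) ∈ 𝓝[S ×ˢ univ] (p, v) := by
    intro p hp v
    rw [nhdsWithin_prod_eq, nhdsWithin_univ]
    exact prod_mem_prod (hmem p hp) univ_mem
  have heq2 : ∀ p₀ ∈ S, ∀ v : V, (fun p : V × V => a p.1 p.1 p.2) =ᶠ[𝓝[S ×ˢ univ] (p₀, v)]
      fun p : V × V => a p₀ p.1 p.2 := fun p₀ hp₀ v => by
    filter_upwards [hmem2 p₀ hp₀ v] with p hp
    rw [heq p₀ hp₀ _ hp.1]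
  refine ⟨fun p => a p p, fun p hp => hder p hp p ⟨hp, hpO p hp⟩, ?_, fun p hp v => ?_⟩
  · rintro ⟨p, v⟩ ⟨hp, -⟩
    have h1 := ((ha p hp).continuousOn (p, v) ⟨⟨hp, hpO p hp⟩, mem_univ _⟩).mono_of_mem_nhdsWithin
      (hmem2 p hp v)
    exact h1.congr_of_eventuallyEq (heq2 p hp v) rfl
  · obtain ⟨D, hD⟩ := (ha p hp).exists_second p ⟨hp, hpO p hp⟩ v
    exact ⟨D, (hD.mono_of_mem_nhdsWithin (hmem2 p hp v)).congr (heq2 p hp v) rfl⟩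

end Form

end LieGroup

/-! ### The structure equation of Maurer and Cartan -/

/-- Young's theorem in the plane: if both partial derivatives of a differentiable function are
differentiable at a point, then the mixed second derivatives agree there. -/
theorem mixed_partials_eq {g a b : ℝ × ℝ → ℝ} {a' b' : ℝ × ℝ →L[ℝ] ℝ}
    (hg : ∀ᶠ s in 𝓝 (0 : ℝ × ℝ), HasFDerivAt g
      (a s • ContinuousLinearMap.fst ℝ ℝ ℝ + b s • ContinuousLinearMap.snd ℝ ℝ ℝ) s)
    (ha : HasFDerivAt a a' 0) (hb : HasFDerivAt b b' 0) : a' (0, 1) = b' (1, 0) := by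
  have h := second_derivative_symmetric_of_eventually hg
    ((ha.smul_const (ContinuousLinearMap.fst ℝ ℝ ℝ)).add
      (hb.smul_const (ContinuousLinearMap.snd ℝ ℝ ℝ))) (0, 1) (1, 0)
  simpa using h

theorem hasDerivAt_line {F : Type*} [AddCommGroup F] [Module ℝ F] [TopologicalSpace F]
    [IsTopologicalAddGroup F] [ContinuousSMul ℝ F] (x v : F) (t : ℝ) :
    HasDerivAt (fun s : ℝ => x + s • v) v t := by
  rw [hasDerivAt_iff_tendsto_quotient]
  refine tendsto_const_nhds.congr' ?_
  filter_upwards [eventually_mem_nhdsWithin] with s hs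
  rw [add_smul, ← add_assoc, add_sub_cancel_left, inv_smul_smul₀ hs]

section LieGroup

variable {E : Type*} [AddCommGroup E] [Module ℝ E] [TopologicalSpace E] [ContinuousSMul ℝ E]
  [IsTopologicalAddGroup E] [LocallyConvexSpace ℝ E] [T2Space E]
variable {L : Type*} [TopologicalSpace L] [ChartedSpace E L] [Group L] [IsLieGroup E L]

variable (E L) in
/-- In the chart at the identity, `Λ x ξ` is the left-invariant field with value `ξ` at the identity,
and `β ξ` is the derivative of this field at the identity; the bracket is the
antisymmetrization of `β`. -/
theorem exists_leftInvField_deriv :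
    ∃ Λ β : E → E →ₗ[ℝ] E,
      (∀ x ∈ (chartAt E (1 : L)).target, HasHadamardDerivWithinAt
        (fun y => chartAt E (1 : L) ((chartAt E (1 : L)).symm x * (chartAt E (1 : L)).symm y))
        (Λ x) univ (chartAt E (1 : L) 1)) ∧
      (∀ ξ, HasHadamardDerivWithinAt (fun q : E × E => Λ q.1 q.2)
        ((β ξ).coprod LinearMap.id) univ (chartAt E (1 : L) 1, ξ)) ∧
      ∀ ξ η, bracket E L ξ η = β η ξ - β ξ η := by
  obtain ⟨Dm, hDm⟩ := exists_isSmoothDerivOn_chartMul (E := E) (1 : L) 1 1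
  set φ := chartAt E (1 : L)
  set Ω := {p : E × E | p.1 ∈ φ.target ∧ p.2 ∈ φ.target ∧ φ.symm p.1 * φ.symm p.2 ∈ φ.source}
  have hΩ : IsOpen Ω := isOpen_chartMul_domain _ _ _
  have h1 : (1 : L) ∈ φ.source := mem_chart_source E 1
  have he : φ 1 ∈ φ.target := φ.map_source h1
  have hse : φ.symm (φ 1) = 1 := φ.left_inv h1
  have hmem : ∀ x ∈ φ.target, (x, φ 1) ∈ Ω := fun x hx =>
    ⟨hx, he, by simpa only [hse, mul_one] using φ.map_target hx⟩
  set Λ : E → E →ₗ[ℝ] E := fun x => Dm (x, φ 1) ∘ₗ LinearMap.inr ℝ E E with hΛdef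
  have hΛ : ∀ x ∈ φ.target, HasHadamardDerivWithinAt
      (fun y => φ (φ.symm x * φ.symm y)) (Λ x) univ (φ 1) := by
    intro x hx
    have hN : {y | (x, y) ∈ Ω} ∈ 𝓝 (φ 1) :=
      (Continuous.prodMk_right x).continuousAt (hΩ.mem_nhds (hmem x hx))
    have h := HasHadamardDerivWithinAt.comp (f := fun y => (x, y)) (hDm.hasDeriv _ (hmem x hx))
      ((hasHadamardDerivWithinAt_const x).prodMk
        (hasHadamardDerivWithinAt_linear LinearMap.id continuous_id)) fun y hy => hy
    exact h.mono_of_mem_nhdsWithin (mem_nhdsWithin_of_mem_nhds hN)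
  have hΛe : Λ (φ 1) = LinearMap.id := by
    refine (hΛ _ he).unique ?_ convex_univ (by simp) (mem_univ _)
    refine (hasHadamardDerivWithinAt_linear LinearMap.id continuous_id).congr ?_ ?_
    · filter_upwards [mem_nhdsWithin_of_mem_nhds (φ.open_target.mem_nhds he)] with y hy
      simp [hse, φ.right_inv hy]
    · simp [hse]
  -- As `Λ (φ 1)` is the identity, the derivative of `Λ` in its second slot at `φ 1` is the identity.
  have hsecond : ∀ ξ, ∃ β : E →ₗ[ℝ] E, HasHadamardDerivWithinAt (fun q : E × E => Λ q.1 q.2)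
      (β.coprod LinearMap.id) univ (φ 1, ξ) := by
    intro ξ
    obtain ⟨D, hD⟩ := hDm.exists_second _ (hmem _ he) (0, ξ)
    have hN : {q : E × E | (q.1, φ 1) ∈ Ω} ∈ 𝓝 (φ 1, ξ) :=
      (continuous_fst.prodMk continuous_const).continuousAt (hΩ.mem_nhds (hmem _ he))
    have h := HasHadamardDerivWithinAt.comp (x := (φ 1, ξ)) (S := {q : E × E | (q.1, φ 1) ∈ Ω})
      (f := fun q : E × E => ((q.1, φ 1), ((0 : E), q.2))) hD
      (((hasHadamardDerivWithinAt_linear (LinearMap.fst ℝ E E) continuous_fst).prodMk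
        (hasHadamardDerivWithinAt_const (φ 1))).prodMk
        ((hasHadamardDerivWithinAt_const (0 : E)).prodMk
          (hasHadamardDerivWithinAt_linear (LinearMap.snd ℝ E E) continuous_snd)))
      fun q hq => ⟨hq, mem_univ _⟩
    have h := h.mono_of_mem_nhdsWithin (S := univ) (mem_nhdsWithin_of_mem_nhds hN)
    set K := D ∘ₗ ((LinearMap.fst ℝ E E).prod (0 : E × E →ₗ[ℝ] E)).prod
      ((0 : E × E →ₗ[ℝ] E).prod (LinearMap.snd ℝ E E))
    have hr : K ∘ₗ LinearMap.inr ℝ E E = LinearMap.id := by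
      have h2 := HasHadamardDerivWithinAt.comp (x := ξ) (S := univ)
        (f := fun η : E => (φ 1, η)) h ((hasHadamardDerivWithinAt_const (φ 1)).prodMk
          (hasHadamardDerivWithinAt_linear LinearMap.id continuous_id)) fun _ _ => mem_univ _
      refine HasHadamardDerivWithinAt.unique h2 ?_ convex_univ (by simp) (mem_univ _)
      refine (hasHadamardDerivWithinAt_linear LinearMap.id continuous_id).congr ?_ ?_
      · exact Eventually.of_forall fun η => congrArg (fun l : E →ₗ[ℝ] E => l η) hΛe
      · exact congrArg (fun l : E →ₗ[ℝ] E => l ξ) hΛe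
    refine ⟨K ∘ₗ LinearMap.inl ℝ E E, ?_⟩
    rw [← hr, ← LinearMap.comp_coprod, LinearMap.coprod_inl_inr, LinearMap.comp_id]
    exact h
  choose β hβ using hsecond
  refine ⟨Λ, β, hΛ, hβ, fun ξ η => ?_⟩
  have hfield : ∀ ζ, ∀ x ∈ φ.target, leftInvField E L ζ x = Λ x ζ := by
    intro ζ x hx
    refine deriv_eq_of_hasDerivAt ?_
    refine HasHadamardDerivWithinAt.hasDerivAt_comp (S := univ)
      (f := fun y => φ (φ.symm x * φ.symm y)) ?_ (hasDerivAt_line (φ 1) ζ 0) (by simp)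
    simpa using hΛ x hx
  have hfield' : ∀ ζ v, deriv (fun t : ℝ => leftInvField E L ζ (φ 1 + t • v)) 0 = β ζ v := by
    intro ζ v
    refine deriv_eq_of_hasDerivAt ?_
    have h2 := HasHadamardDerivWithinAt.comp (x := φ 1) (S := univ)
      (f := fun x : E => (x, ζ)) (hβ ζ)
      ((hasHadamardDerivWithinAt_linear LinearMap.id continuous_id).prodMk
        (hasHadamardDerivWithinAt_const ζ)) fun _ _ => mem_univ _
    have h3 : HasHadamardDerivWithinAt (fun x => leftInvField E L ζ x) (β ζ) univ (φ 1) := by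
      have e : (β ζ).coprod LinearMap.id ∘ₗ (LinearMap.id.prod (0 : E →ₗ[ℝ] E)) = β ζ := by
        ext; simp
      rw [e] at h2
      refine h2.congr ?_ (hfield ζ _ he)
      filter_upwards [mem_nhdsWithin_of_mem_nhds (φ.open_target.mem_nhds he)] with x hx
      exact hfield ζ x hx
    refine HasHadamardDerivWithinAt.hasDerivAt_comp (S := univ) ?_ (hasDerivAt_line (φ 1) v 0)
      (by simp)
    simpa using h3
  have hval : ∀ ζ, leftInvField E L ζ (φ 1) = ζ := fun ζ => by rw [hfield ζ _ he, hΛe]; rfl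
  change deriv (fun t : ℝ => leftInvField E L η (φ 1 + t • leftInvField E L ξ (φ 1))) 0 -
    deriv (fun t : ℝ => leftInvField E L ξ (φ 1 + t • leftInvField E L η (φ 1))) 0 = _
  rw [hval, hval, hfield', hfield']

variable {V : Type*} [AddCommGroup V] [Module ℝ V] [TopologicalSpace V] [IsTopologicalAddGroup V]
  [ContinuousSMul ℝ V]

/-- `∂_v A_w - ∂_w A_v = -[A_v, A_w]`. The translate `U(q) = h(p)⁻¹ h(q)`, read in the chart at the
identity, satisfies `∂_v U = Λ(U, A_v)` with `Λ` the left-invariant fields; differentiating once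
more and using the symmetry of the second derivatives of `U` at `p` gives the equation. -/
theorem IsMaurerCartanOn.structure_equation {h : V → L} {A : V → V →ₗ[ℝ] E} {S : Set V}
    (hA : IsMaurerCartanOn h A S) (hc : ContinuousOn h S) {p v w : V} (hp : p ∈ interior S)
    {Dv Dw : V × V →ₗ[ℝ] E}
    (hDv : HasHadamardDerivWithinAt (fun x : V × V => A x.1 x.2) Dv (S ×ˢ univ) (p, v))
    (hDw : HasHadamardDerivWithinAt (fun x : V × V => A x.1 x.2) Dw (S ×ˢ univ) (p, w)) :
    Dw (v, 0) - Dv (w, 0) = -bracket E L (A p v) (A p w) := by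
  have := IsLieGroup.toIsTopologicalGroup E (L := L)
  obtain ⟨Λ, β, hΛ, hβ, hbr⟩ := exists_leftInvField_deriv E L
  set φ := chartAt E (1 : L)
  have h1 : (1 : L) ∈ φ.source := mem_chart_source E 1
  have hpS : p ∈ S := interior_subset hp
  have hnear : ∀ q ∈ S, ∀ᶠ q' in 𝓝[S] q, (h q)⁻¹ * h q' ∈ φ.source := fun q hq => by
    have h2 : Tendsto (fun q' => (h q)⁻¹ * h q') (𝓝[S] q) (𝓝 1) := by
      simpa using (hc q hq).tendsto.const_mul (h q)⁻¹
    exact h2.eventually (φ.open_source.mem_nhds h1)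
  set U : V → E := fun q => φ ((h p)⁻¹ * h q) with hU
  have hUp : U p = φ 1 := by simp [hU]
  have hUder : ∀ q ∈ S, (h p)⁻¹ * h q ∈ φ.source →
      HasHadamardDerivWithinAt U (Λ (U q) ∘ₗ A q) S q := by
    intro q hq hqs
    have h2 := hΛ (U q) (φ.map_source hqs)
    have h3 := hA.hasDeriv q hq
    have e : φ ((h q)⁻¹ * h q) = φ 1 := by simp
    rw [← e] at h2
    refine (h2.comp (f := fun q' => φ ((h q)⁻¹ * h q')) h3 fun _ _ => mem_univ _).congr ?_ ?_
    · filter_upwards [hnear q hq] with q' hq'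
      simp only [hU, φ.left_inv hqs, φ.left_inv hq']
      group
    · simp only [hU, φ.left_inv hqs, e, φ.left_inv h1, mul_one]
  set P : ℝ × ℝ → V := fun s => p + (s.1 • v + s.2 • w)
  set P' : ℝ × ℝ →ₗ[ℝ] V :=
    (LinearMap.toSpanSingleton ℝ V v).coprod (LinearMap.toSpanSingleton ℝ V w)
  have hPc : Continuous P := by fun_prop
  have hP0 : P 0 = p := by simp [P]
  have hP : ∀ (s : ℝ × ℝ) (T : Set (ℝ × ℝ)), HasHadamardDerivWithinAt P P' T s := by
    intro s T u
    have hP'c : Continuous P' := by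
      have : (P' : ℝ × ℝ → V) = fun s => s.1 • v + s.2 • w := by ext s; simp [P']
      rw [this]; fun_prop
    refine (hasHadamardDerivWithinAt_linear P' hP'c u).congr fun q => ?_
    simp [P, P']
  have hPS : P ⁻¹' S ∈ 𝓝 (0 : ℝ × ℝ) :=
    hPc.continuousAt (by rw [hP0]; exact mem_interior_iff_mem_nhds.1 hp)
  -- The two partial derivatives of `U ∘ P`, and their derivatives at the origin.
  have hpart : ∀ {u : V} {Du : V × V →ₗ[ℝ] E},
      HasHadamardDerivWithinAt (fun x : V × V => A x.1 x.2) Du (S ×ˢ univ) (p, u) →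
      HasHadamardDerivWithinAt (fun s => Λ (U (P s)) (A (P s) u))
        ((β (A p u)).coprod LinearMap.id ∘ₗ
          ((A p ∘ₗ P').prod (Du ∘ₗ P'.prod 0))) (P ⁻¹' S) 0 := by
    intro u Du hDu
    have h2 : HasHadamardDerivWithinAt (fun s => U (P s)) (A p ∘ₗ P') (P ⁻¹' S) 0 := by
      have h3 := hA.hasDeriv p hpS
      rw [← hP0] at h3
      have h4 := h3.comp (hP 0 (P ⁻¹' S)) (mapsTo_preimage _ _)
      rwa [hP0] at h4
    have h5 : HasHadamardDerivWithinAt (fun s => A (P s) u) (Du ∘ₗ P'.prod 0) (P ⁻¹' S) 0 := by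
      rw [← hP0] at hDu
      exact HasHadamardDerivWithinAt.comp (x := 0) (f := fun s => (P s, u)) hDu
        ((hP 0 (P ⁻¹' S)).prodMk (hasHadamardDerivWithinAt_const u)) fun s hs => ⟨hs, mem_univ _⟩
    have h6 : HasHadamardDerivWithinAt (fun q : E × E => Λ q.1 q.2)
        ((β (A p u)).coprod LinearMap.id) univ (U (P 0), A (P 0) u) := by
      rw [hP0, hUp]; exact hβ _
    exact HasHadamardDerivWithinAt.comp (x := 0) (f := fun s => (U (P s), A (P s) u)) h6
      (h2.prodMk h5) fun _ _ => mem_univ _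
  have hgood : ∀ᶠ s in 𝓝 (0 : ℝ × ℝ), P s ∈ interior S ∧ (h p)⁻¹ * h (P s) ∈ φ.source := by
    have h2 : ∀ᶠ q in 𝓝 p, q ∈ interior S ∧ (h p)⁻¹ * h q ∈ φ.source := by
      have h3 := hnear p hpS
      rw [nhdsWithin_eq_nhds.2 (mem_interior_iff_mem_nhds.1 hp)] at h3
      exact (isOpen_interior.eventually_mem hp).and h3
    exact (hPc.tendsto' 0 p hP0).eventually h2
  have hfun : ∀ l : StrongDual ℝ E,
      l (β (A p v) (A p w) + Dv (w, 0)) = l (β (A p w) (A p v) + Dw (v, 0)) := by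
    intro l
    have hl : ∀ x : E, HasHadamardDerivWithinAt l (l : E →ₗ[ℝ] ℝ) univ x := fun x =>
      hasHadamardDerivWithinAt_linear (l : E →ₗ[ℝ] ℝ) l.continuous
    have hg : ∀ᶠ s in 𝓝 (0 : ℝ × ℝ), HasFDerivAt (fun s => l (U (P s)))
        (l (Λ (U (P s)) (A (P s) v)) • ContinuousLinearMap.fst ℝ ℝ ℝ +
          l (Λ (U (P s)) (A (P s) w)) • ContinuousLinearMap.snd ℝ ℝ ℝ) s := by
      filter_upwards [hgood] with s hs
      have h2 := (hUder _ (interior_subset hs.1) hs.2).comp (hP s (P ⁻¹' S)) (mapsTo_preimage _ _)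
      have h3 := ((hl _).comp h2 fun _ _ => mem_univ _).hasFDerivAt
        (hPc.continuousAt (mem_interior_iff_mem_nhds.1 hs.1))
      refine h3.congr_fderiv ?_
      ext <;> simp [P']
    have ha := ((hl _).comp (hpart hDv) fun _ _ => mem_univ _).hasFDerivAt hPS
    have hb := ((hl _).comp (hpart hDw) fun _ _ => mem_univ _).hasFDerivAt hPS
    have h2 := mixed_partials_eq hg ha hb
    simpa [P'] using h2
  have hkey : β (A p v) (A p w) + Dv (w, 0) = β (A p w) (A p v) + Dw (v, 0) := by
    by_contra hne
    obtain ⟨l, hl⟩ := geometric_hahn_banach_point_point hne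
    exact hl.ne (hfun l)
  rw [hbr, neg_sub, sub_eq_sub_iff_add_eq_add, add_comm, ← hkey, add_comm]

end LieGroup

/-! ### Closedness of the pulled back form -/

section Closed

variable {E : Type*} [AddCommGroup E] [Module ℝ E] [TopologicalSpace E]
variable {L : Type*} [TopologicalSpace L] [ChartedSpace E L] [Group L]

variable (L) in
theorem bracket_skew (ξ η : E) : bracket E L ξ η = -bracket E L η ξ := by
  simp only [bracket, neg_sub]

variable {V : Type*} [AddCommGroup V] [Module ℝ V] [TopologicalSpace V] [IsTopologicalAddGroup V]
  [ContinuousSMul ℝ V]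
variable [T2Space E] {h : V → L} {A : V → V →ₗ[ℝ] E} {S : Set V}

/-- In the direction variable `A` is linear, hence its own derivative. -/
theorem IsMaurerCartanOn.second_apply (hA : IsMaurerCartanOn h A S) {p x : V} (hp : p ∈ S)
    {D : V × V →ₗ[ℝ] E}
    (hD : HasHadamardDerivWithinAt (fun q : V × V => A q.1 q.2) D (S ×ˢ univ) (p, x)) (v w : V) :
    D (v, w) = D (v, 0) + A p w := by
  have hAc : Continuous (A p) :=
    continuousOn_univ.1 (hA.continuousOn.comp (f := fun w : V => (p, w)) (by fun_prop)
      fun w _ => ⟨hp, mem_univ w⟩)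
  have h1 := HasHadamardDerivWithinAt.comp (x := x) (S := univ) (f := fun w : V => (p, w)) hD
    ((hasHadamardDerivWithinAt_const p).prodMk
      (hasHadamardDerivWithinAt_linear LinearMap.id continuous_id)) fun w _ => ⟨hp, mem_univ w⟩
  have h2 := HasHadamardDerivWithinAt.unique h1 (hasHadamardDerivWithinAt_linear (A p) hAc)
    convex_univ (by simp) (mem_univ _)
  have h3 := congrArg (fun l : V →ₗ[ℝ] E => l w) h2
  change D (0, w) = A p w at h3
  rw [← h3, ← map_add]
  simp

variable [ContinuousSMul ℝ E] [IsTopologicalAddGroup E]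

theorem IsMaurerCartanOn.leftLogDeriv_eq (hA : IsMaurerCartanOn h A S) {γ : ℝ → V} {v : V} {t : ℝ}
    (hγ : HasDerivAt γ v t) (hS : ∀ᶠ s in 𝓝 t, γ s ∈ S) :
    leftLogDeriv E (fun s => h (γ s)) t = A (γ t) v :=
  deriv_eq_of_hasDerivAt ((hA.hasDeriv _ hS.self_of_nhds).hasDerivAt_comp hγ hS)

variable [LocallyConvexSpace ℝ E] [IsLieGroup E L]

/-- Let `p : Z → S` be a parametrization of part of the domain of `h` by a finite-dimensional space,
and `X₀, X₁, X₂` its partial derivatives along `e₀, e₁, e₂`, with symmetric second derivatives. The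
pullback of the left-invariant form of a cocycle has the components `ω (A Xᵢ) (A Xⱼ)`, and
its exterior derivative, a cyclic sum, vanishes. -/
theorem IsMaurerCartanOn.exists_hasFDerivAt_closed {Z : Type*} [NormedAddCommGroup Z]
    [NormedSpace ℝ Z] [FiniteDimensional ℝ Z] {ω : E →ₗ[ℝ] E →ₗ[ℝ] ℂ} (hω : IsTwoCocycle E L ω)
    (hA : IsMaurerCartanOn h A S) (hc : ContinuousOn h S) {p X₀ X₁ X₂ : Z → V}
    {p' X₀' X₁' X₂' : Z →ₗ[ℝ] V} {z e₀ e₁ e₂ : Z} (hpc : ContinuousAt p z)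
    (hz : p z ∈ interior S)
    (hp : HasHadamardDerivWithinAt p p' univ z) (h₀ : HasHadamardDerivWithinAt X₀ X₀' univ z)
    (h₁ : HasHadamardDerivWithinAt X₁ X₁' univ z) (h₂ : HasHadamardDerivWithinAt X₂ X₂' univ z)
    (hp₀ : p' e₀ = X₀ z) (hp₁ : p' e₁ = X₁ z) (hp₂ : p' e₂ = X₂ z)
    (h₀₁ : X₀' e₁ = X₁' e₀) (h₀₂ : X₀' e₂ = X₂' e₀) (h₁₂ : X₁' e₂ = X₂' e₁) :
    ∃ β₁₂ β₀₂ β₀₁ : Z →L[ℝ] ℂ,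
      HasFDerivAt (fun y => ω (A (p y) (X₁ y)) (A (p y) (X₂ y))) β₁₂ z ∧
      HasFDerivAt (fun y => ω (A (p y) (X₀ y)) (A (p y) (X₂ y))) β₀₂ z ∧
      HasFDerivAt (fun y => ω (A (p y) (X₀ y)) (A (p y) (X₁ y))) β₀₁ z ∧
      β₁₂ e₀ - β₀₂ e₁ + β₀₁ e₂ = 0 := by
  have hzS := interior_subset hz
  have hN : p ⁻¹' S ∈ 𝓝 z := hpc (mem_interior_iff_mem_nhds.1 hz)
  obtain ⟨D₀, hD₀⟩ := hA.exists_second _ hzS (X₀ z)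
  obtain ⟨D₁, hD₁⟩ := hA.exists_second _ hzS (X₁ z)
  obtain ⟨D₂, hD₂⟩ := hA.exists_second _ hzS (X₂ z)
  have hX : ∀ {X : Z → V} {X' : Z →ₗ[ℝ] V} {D : V × V →ₗ[ℝ] E},
      HasHadamardDerivWithinAt (fun q : V × V => A q.1 q.2) D (S ×ˢ univ) (p z, X z) →
      HasHadamardDerivWithinAt X X' univ z →
      HasHadamardDerivWithinAt (fun y => A (p y) (X y)) (D ∘ₗ p'.prod X') (p ⁻¹' S) z := by
    intro X X' D hD hX
    exact HasHadamardDerivWithinAt.comp (f := fun y => (p y, X y)) hD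
      ((hp.prodMk hX).mono (subset_univ _)) fun y hy => ⟨hy, mem_univ _⟩
  have hA₀ := hX hD₀ h₀
  have hA₁ := hX hD₁ h₁
  have hA₂ := hX hD₂ h₂
  refine ⟨_, _, _, (HasHadamardDerivWithinAt.bilinear hω.continuous hA₁ hA₂).hasFDerivAt hN,
    (HasHadamardDerivWithinAt.bilinear hω.continuous hA₀ hA₂).hasFDerivAt hN,
    (HasHadamardDerivWithinAt.bilinear hω.continuous hA₀ hA₁).hasFDerivAt hN, ?_⟩
  have e₀₁ := hA.structure_equation hc hz hD₀ hD₁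
  have e₀₂ := hA.structure_equation hc hz hD₀ hD₂
  have e₁₂ := hA.structure_equation hc hz hD₁ hD₂
  -- By the structure equation the bracket terms of the cocycle identity are the differences
  -- `Dⱼ (Xᵢ, 0) - Dᵢ (Xⱼ, 0)`; the second derivatives of `p` cancel by symmetry.
  have hcyc := hω.cocycle (A (p z) (X₀ z)) (A (p z) (X₁ z)) (A (p z) (X₂ z))
  rw [bracket_skew L (A (p z) (X₂ z)), ← e₀₂, neg_eq_iff_eq_neg.1 e₀₁.symm,
    neg_eq_iff_eq_neg.1 e₁₂.symm] at hcyc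
  have hexp : ∀ (a b : E) (a' b' : Z →ₗ[ℝ] E) (e : Z), LinearMap.toContinuousLinearMap
      (ω.flip b ∘ₗ a' + ω a ∘ₗ b') e = ω (a' e) b + ω a (b' e) := fun _ _ _ _ _ => rfl
  have hcomp : ∀ (D : V × V →ₗ[ℝ] E) (X' : Z →ₗ[ℝ] V) (e : Z),
      (D ∘ₗ p'.prod X') e = D (p' e, X' e) := fun _ _ _ => rfl
  simp only [hexp, hcomp, hp₀, hp₁, hp₂]
  rw [hA.second_apply hzS hD₀ _ (X₀' e₁), hA.second_apply hzS hD₀ _ (X₀' e₂),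
    hA.second_apply hzS hD₁ _ (X₁' e₀), hA.second_apply hzS hD₁ _ (X₁' e₂),
    hA.second_apply hzS hD₂ _ (X₂' e₀), hA.second_apply hzS hD₂ _ (X₂' e₁), h₀₁, h₀₂, h₁₂]
  simp only [map_add, map_sub, map_neg, LinearMap.add_apply, LinearMap.sub_apply,
    LinearMap.neg_apply] at hcyc ⊢
  rw [hω.skew (D₂ _) (A (p z) (X₁ z)), hω.skew (D₀ (X₂ z, 0)) (A (p z) (X₁ z)),
    hω.skew (D₂ (X₁ z, 0)) (A (p z) (X₀ z)), hω.skew (D₁ (X₂ z, 0)) (A (p z) (X₀ z))] at hcyc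
  rw [hω.skew (D₀ (X₂ z, 0)) (A (p z) (X₁ z)),
    hω.skew (A (p z) (X₂' e₀)) (A (p z) (X₁ z))]
  linear_combination -hcyc

end Closed

/-! ### Integration over the disk in polar coordinates -/

section Integration

theorem setIntegral_Icc_fin_two (f : (Fin 2 → ℝ) → ℂ) (a b c d : ℝ) :
    ∫ x in Icc ![a, c] ![b, d], f x = ∫ p in Icc a b ×ˢ Icc c d, f ![p.1, p.2] := by
  have h := (volume_preserving_finTwoArrow ℝ).symm.setIntegral_preimage_emb
    (MeasurableEquiv.finTwoArrow (α := ℝ)).symm.measurableEmbedding f (Icc ![a, c] ![b, d])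
  rw [← h]
  congr 2
  ext p
  simp [Pi.le_def, Prod.le_def, MeasurableEquiv.finTwoArrow, Fin.forall_fin_two]

/-- Divergence theorem on `[a, b] × [0, 1] × [-π, π]` for a closed form with coefficients `W, Θ, Ψ`:
by periodicity the faces at `±π` cancel, and the face at `0` contributes nothing. -/
theorem integral_sub_eq_of_closed {a b : ℝ} (hab : a ≤ b) {W Θ Ψ : (Fin 3 → ℝ) → ℂ}
    (hW : ContinuousOn W (Icc ![a, 0, -Real.pi] ![b, 1, Real.pi]))
    (hΘ : ContinuousOn Θ (Icc ![a, 0, -Real.pi] ![b, 1, Real.pi]))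
    (hΨ : ContinuousOn Ψ (Icc ![a, 0, -Real.pi] ![b, 1, Real.pi]))
    (hd : ∀ z : Fin 3 → ℝ, z 0 ∈ Ioo a b → z 1 ∈ Ioo (0 : ℝ) 1 →
      ∃ W' Θ' Ψ' : (Fin 3 → ℝ) →L[ℝ] ℂ, HasFDerivAt W W' z ∧ HasFDerivAt Θ Θ' z ∧
        HasFDerivAt Ψ Ψ' z ∧
        W' (Pi.single 0 1) - Θ' (Pi.single 1 1) + Ψ' (Pi.single 2 1) = 0)
    (hΘ0 : ∀ ε s, Θ ![ε, 0, s] = 0) (hΨp : ∀ ε ρ, Ψ ![ε, ρ, Real.pi] = Ψ ![ε, ρ, -Real.pi]) :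
    (∫ p in Icc (0 : ℝ) 1 ×ˢ Icc (-Real.pi) Real.pi, W ![b, p.1, p.2]) -
      (∫ p in Icc (0 : ℝ) 1 ×ˢ Icc (-Real.pi) Real.pi, W ![a, p.1, p.2]) =
      ∫ p in Icc a b ×ˢ Icc (-Real.pi) Real.pi, Θ ![p.1, 1, p.2] := by
  choose! W' Θ' Ψ' hW' hΘ' hΨ' hdiv using hd
  set B := pi univ fun i => Ioo ((![a, 0, -Real.pi] : Fin 3 → ℝ) i) (![b, 1, Real.pi] i)
  have hB : ∀ z ∈ B, z 0 ∈ Ioo a b ∧ z 1 ∈ Ioo (0 : ℝ) 1 := fun z hz =>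
    ⟨hz 0 (mem_univ _), hz 1 (mem_univ _)⟩
  -- Outside the open box, where nothing is known, the derivatives are replaced by zero.
  classical
  set G : Fin 3 → (Fin 3 → ℝ) → ℂ := ![W, fun z => -Θ z, Ψ] with hG
  set G' : Fin 3 → (Fin 3 → ℝ) → (Fin 3 → ℝ) →L[ℝ] ℂ := fun i z =>
    if z ∈ B then (![W' z, -Θ' z, Ψ' z] : Fin 3 → (Fin 3 → ℝ) →L[ℝ] ℂ) i else 0 with hG'
  have hzero : (fun z => ∑ i, G' i z (Pi.single i 1)) = fun _ => 0 := by
    ext z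
    by_cases hz : z ∈ B
    · have h1 := hdiv z (hB z hz).1 (hB z hz).2
      simp only [hG', hz, if_true, Fin.sum_univ_three, Matrix.cons_val_zero, Matrix.cons_val_one,
        Matrix.cons_val, _root_.neg_apply]
      rw [← h1]
      ring
    · simp [hG', hz]
  have key := integral_divergence_of_hasFDerivAt_off_countable' (![a, 0, -Real.pi] : Fin 3 → ℝ)
    ![b, 1, Real.pi] ?_ G G' ∅ countable_empty ?_ ?_ ?_
  · have hs : (fun z => ∑ i, G' i z (Pi.single i (1 : ℝ))) = fun _ => 0 := hzero
    rw [hs, integral_zero, Fin.sum_univ_three] at key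
    have c0 : ∀ x y z : ℝ, (![x, y, z] : Fin 3 → ℝ) ∘ Fin.succAbove 0 = ![y, z] := fun x y z => by
      ext i; fin_cases i <;> rfl
    have c1 : ∀ x y z : ℝ, (![x, y, z] : Fin 3 → ℝ) ∘ Fin.succAbove 1 = ![x, z] := fun x y z => by
      ext i; fin_cases i <;> rfl
    have c2 : ∀ x y z : ℝ, (![x, y, z] : Fin 3 → ℝ) ∘ Fin.succAbove 2 = ![x, y] := fun x y z => by
      ext i; fin_cases i <;> rfl
    have i0 : ∀ x y z : ℝ, (Fin.insertNth 0 x ![y, z] : Fin 3 → ℝ) = ![x, y, z] := fun x y z => by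
      ext i; fin_cases i <;> rfl
    have i1 : ∀ x y z : ℝ, (Fin.insertNth 1 x ![y, z] : Fin 3 → ℝ) = ![y, x, z] := fun x y z => by
      ext i; fin_cases i <;> rfl
    have i2 : ∀ x y z : ℝ, (Fin.insertNth 2 x ![y, z] : Fin 3 → ℝ) = ![y, z, x] := fun x y z => by
      ext i; fin_cases i <;> rfl
    simp only [c0, c1, c2, setIntegral_Icc_fin_two] at key
    simp only [i0, i1, i2, hG, Matrix.cons_val_zero, Matrix.cons_val_one, Matrix.cons_val, hΘ0, hΨp,
      integral_neg, neg_zero, integral_zero, sub_self, add_zero, sub_zero] at key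
    linear_combination -key
  · intro i
    fin_cases i <;> simp [hab, Real.pi_pos.le]
  · intro i
    fin_cases i
    exacts [hW, hΘ.neg, hΨ]
  · rintro z ⟨hz, -⟩ i
    have hz' : z ∈ B := hz
    obtain ⟨h0, h1⟩ := hB z hz'
    simp only [hG', hz', if_true]
    fin_cases i
    exacts [hW' z h0 h1, (hΘ' z h0 h1).neg, hΨ' z h0 h1]
  · rw [hzero]
    exact integrableOn_zero

theorem convex_unitDisk : Convex ℝ unitDisk := by
  intro p hp q hq s t hs ht hst
  simp only [unitDisk, mem_ofPred_eq, Prod.fst_add, Prod.smul_fst, Prod.snd_add, Prod.smul_snd,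
    smul_eq_mul] at *
  obtain rfl : t = 1 - s := by linarith
  nlinarith [mul_nonneg hs ht, mul_nonneg (mul_nonneg hs ht) (sq_nonneg (p.1 - q.1)),
    mul_nonneg (mul_nonneg hs ht) (sq_nonneg (p.2 - q.2))]

theorem isClosed_unitDisk : IsClosed unitDisk :=
  isClosed_le (by fun_prop) continuous_const

theorem isCompact_unitDisk : IsCompact unitDisk := by
  refine (isCompact_Icc (a := ((-1, -1) : ℝ × ℝ)) (b := (1, 1))).of_isClosed_subset
    isClosed_unitDisk fun p (hp : p.1 ^ 2 + p.2 ^ 2 ≤ 1) => ?_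
  simp only [← Icc_prod_Icc, mem_prod, mem_Icc]
  refine ⟨⟨?_, ?_⟩, ?_, ?_⟩ <;> nlinarith

theorem mem_interior_unitDisk {p : ℝ × ℝ} (hp : p.1 ^ 2 + p.2 ^ 2 < 1) : p ∈ interior unitDisk := by
  have hO : IsOpen {p : ℝ × ℝ | p.1 ^ 2 + p.2 ^ 2 < 1} :=
    isOpen_lt (by fun_prop) continuous_const
  have hsub : {p : ℝ × ℝ | p.1 ^ 2 + p.2 ^ 2 < 1} ⊆ unitDisk := by
    intro q hq
    simp only [unitDisk, mem_ofPred_eq] at hq ⊢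
    exact hq.le
  exact interior_maximal hsub hO hp

theorem setIntegral_unitDisk_eq_polar (f : ℝ × ℝ → ℂ) :
    ∫ q in unitDisk, f q = ∫ p in Icc (0 : ℝ) 1 ×ˢ Icc (-Real.pi) Real.pi,
      p.1 • f (p.1 * Real.cos p.2, p.1 * Real.sin p.2) := by
  rw [← integral_indicator isClosed_unitDisk.measurableSet, ← integral_comp_polarCoord_symm]
  have h1 : ∀ p ∈ polarCoord.target, p.1 • unitDisk.indicator f (polarCoord.symm p) =
      (Iic (1 : ℝ) ×ˢ (univ : Set ℝ)).indicator
        (fun p => p.1 • f (p.1 * Real.cos p.2, p.1 * Real.sin p.2)) p := by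
    rintro ⟨ρ, s⟩ ⟨hρ, -⟩
    have hρ' : 0 < ρ := hρ
    have hiff : (ρ * Real.cos s, ρ * Real.sin s) ∈ unitDisk ↔
        (ρ, s) ∈ Iic (1 : ℝ) ×ˢ (univ : Set ℝ) := by
      have e : (ρ * Real.cos s) ^ 2 + (ρ * Real.sin s) ^ 2 = ρ ^ 2 := by
        linear_combination ρ ^ 2 * Real.sin_sq_add_cos_sq s
      simp only [unitDisk, mem_ofPred_eq, e, mem_prod, mem_Iic, mem_univ, and_true]
      exact pow_le_one_iff_of_nonneg hρ'.le two_ne_zero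
    by_cases hm : (ρ * Real.cos s, ρ * Real.sin s) ∈ unitDisk
    · rw [indicator_of_mem (hiff.1 hm)]
      simp [polarCoord, indicator_of_mem hm]
    · rw [indicator_of_notMem (mt hiff.2 hm)]
      simp [polarCoord, indicator_of_notMem hm]
  rw [setIntegral_congr_fun polarCoord.open_target.measurableSet h1,
    setIntegral_indicator (measurableSet_Iic.prod MeasurableSet.univ)]
  refine setIntegral_congr_set ?_
  -- The polar chart omits the ray at angle `π`; this and the origin are null sets.
  have h2 : polarCoord.target ∩ Iic (1 : ℝ) ×ˢ (univ : Set ℝ) =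
      Ioc (0 : ℝ) 1 ×ˢ Ioo (-Real.pi) Real.pi := by
    ext ⟨ρ, s⟩
    simp [polarCoord]
    tauto
  rw [h2]
  exact Measure.set_prod_ae_eq Ioc_ae_eq_Icc Ioo_ae_eq_Icc

/-- A function whose increments on `[a, b]` are the integrals of a continuous density that is itself
an integral over a parameter, is differentiable in the interior. -/
theorem hasDerivAt_of_forall_sub_eq {a b c d : ℝ} (hcd : c ≤ d) {F : ℝ → ℂ} {θ : ℝ × ℝ → ℂ}
    (hθ : ContinuousOn θ (Icc a b ×ˢ univ))
    (hF : ∀ ε ∈ Icc a b, F ε - F a = ∫ p in Icc a ε ×ˢ Icc c d, θ p) {ε : ℝ} (hε : ε ∈ Ioo a b) :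
    HasDerivAt F (∫ s in c..d, θ (ε, s)) ε := by
  have hab : a ≤ b := (hε.1.trans hε.2).le
  -- Freezing `t` outside `[a, b]` makes the density continuous everywhere.
  set θ' : ℝ → ℝ → ℂ := fun t s => θ (projIcc a b hab t, s) with hθ'
  have hθc : Continuous fun p : ℝ × ℝ => θ' p.1 p.2 := by
    refine hθ.comp_continuous (f := fun p : ℝ × ℝ => ((projIcc a b hab p.1 : ℝ), p.2)) ?_
      fun p => ⟨(projIcc a b hab p.1).2, mem_univ _⟩
    fun_prop
  have hg : Continuous fun t => ∫ s in c..d, θ' t s :=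
    intervalIntegral.continuous_parametric_intervalIntegral_of_continuous' hθc c d
  have h1 : HasDerivAt (fun t => F a + ∫ u in a..t, ∫ s in c..d, θ' u s)
      (∫ s in c..d, θ' ε s) ε :=
    (intervalIntegral.integral_hasDerivAt_right (hg.intervalIntegrable _ _)
      hg.aestronglyMeasurable.stronglyMeasurableAtFilter hg.continuousAt).const_add _
  have heq : ∀ t ∈ Icc a b, ∀ s, θ' t s = θ (t, s) := fun t ht s => by
    simp only [hθ', projIcc_of_mem hab ht]
  have h2 : (∫ s in c..d, θ (ε, s)) = ∫ s in c..d, θ' ε s :=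
    intervalIntegral.integral_congr fun s _ => (heq ε (Ioo_subset_Icc_self hε) s).symm
  rw [h2]
  refine h1.congr_of_eventuallyEq ?_
  filter_upwards [Ioo_mem_nhds hε.1 hε.2] with t ht
  have ht' := Ioo_subset_Icc_self ht
  have h3 : ∫ p in Icc a t ×ˢ Icc c d, θ p = ∫ p in Icc a t ×ˢ Icc c d, θ' p.1 p.2 :=
    setIntegral_congr_fun (measurableSet_Icc.prod measurableSet_Icc) fun p hp =>
      (heq p.1 ⟨hp.1.1, hp.1.2.trans ht'.2⟩ p.2).symm
  rw [← sub_eq_iff_eq_add', hF t ht', h3, Measure.volume_eq_prod, setIntegral_prod _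
    (hθc.continuousOn.integrableOn_compact (isCompact_Icc.prod isCompact_Icc)),
    intervalIntegral.integral_of_le ht'.1, integral_Icc_eq_integral_Ioc]
  refine setIntegral_congr_fun measurableSet_Ioc fun u _ => ?_
  simp only [intervalIntegral.integral_of_le hcd, integral_Icc_eq_integral_Ioc]

end Integration

/-! ### Cylindrical coordinates -/

section Polar

/-- The point of `ℝ × ℝ²` with cylindrical coordinates `z = (ε, ρ, s)`. -/
noncomputable def cylCoord (z : Fin 3 → ℝ) : ℝ × (ℝ × ℝ) :=
  (z 0, (z 1 * Real.cos (z 2), z 1 * Real.sin (z 2)))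

/-- The derivative of `cylCoord` in the radial coordinate `ρ`. -/
noncomputable def radialField (z : Fin 3 → ℝ) : ℝ × (ℝ × ℝ) :=
  (0, (Real.cos (z 2), Real.sin (z 2)))

/-- The derivative of `cylCoord` in the angular coordinate `s`. -/
noncomputable def angularField (z : Fin 3 → ℝ) : ℝ × (ℝ × ℝ) :=
  (0, (-(z 1 * Real.sin (z 2)), z 1 * Real.cos (z 2)))

theorem continuous_cylCoord : Continuous cylCoord := by unfold cylCoord; fun_prop

theorem continuous_radialField : Continuous radialField := by unfold radialField; fun_prop

theorem continuous_angularField : Continuous angularField := by unfold angularField; fun_prop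

theorem exists_hasFDerivAt_cylCoord (z : Fin 3 → ℝ) :
    ∃ p' : (Fin 3 → ℝ) →L[ℝ] ℝ × (ℝ × ℝ), HasFDerivAt cylCoord p' z ∧
      p' (Pi.single 0 1) = (1, (0, 0)) ∧ p' (Pi.single 1 1) = radialField z ∧
      p' (Pi.single 2 1) = angularField z := by
  have h (i : Fin 3) : HasFDerivAt (fun z : Fin 3 → ℝ => z i)
    (ContinuousLinearMap.proj (R := ℝ) (φ := fun _ : Fin 3 => ℝ) i) z := hasFDerivAt_apply i z
  refine ⟨_, (h 0).prodMk (((h 1).mul (h 2).cos).prodMk ((h 1).mul (h 2).sin)), ?_, ?_, ?_⟩ <;>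
    simp [radialField, angularField]

theorem exists_hasFDerivAt_radialField (z : Fin 3 → ℝ) :
    ∃ X' : (Fin 3 → ℝ) →L[ℝ] ℝ × (ℝ × ℝ), HasFDerivAt radialField X' z ∧
      X' (Pi.single 0 1) = 0 ∧
      X' (Pi.single 2 1) = (0, (-Real.sin (z 2), Real.cos (z 2))) := by
  have h (i : Fin 3) : HasFDerivAt (fun z : Fin 3 → ℝ => z i)
    (ContinuousLinearMap.proj (R := ℝ) (φ := fun _ : Fin 3 => ℝ) i) z := hasFDerivAt_apply i z
  refine ⟨_, (hasFDerivAt_const 0 z).prodMk ((h 2).cos.prodMk (h 2).sin), ?_, ?_⟩ <;> simp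

theorem exists_hasFDerivAt_angularField (z : Fin 3 → ℝ) :
    ∃ X' : (Fin 3 → ℝ) →L[ℝ] ℝ × (ℝ × ℝ), HasFDerivAt angularField X' z ∧
      X' (Pi.single 0 1) = 0 ∧
      X' (Pi.single 1 1) = (0, (-Real.sin (z 2), Real.cos (z 2))) := by
  have h (i : Fin 3) : HasFDerivAt (fun z : Fin 3 → ℝ => z i)
    (ContinuousLinearMap.proj (R := ℝ) (φ := fun _ : Fin 3 => ℝ) i) z := hasFDerivAt_apply i z
  refine ⟨_, (hasFDerivAt_const 0 z).prodMk
    (((h 1).mul (h 2).sin).neg.prodMk ((h 1).mul (h 2).cos)), ?_, ?_⟩ <;> simp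

theorem cylCoord_mem {s : Set ℝ} {z : Fin 3 → ℝ} (h0 : z 0 ∈ s) (h1 : z 1 ∈ Icc (0 : ℝ) 1) :
    cylCoord z ∈ s ×ˢ unitDisk := by
  refine ⟨h0, ?_⟩
  have e : (z 1 * Real.cos (z 2)) ^ 2 + (z 1 * Real.sin (z 2)) ^ 2 = z 1 ^ 2 := by
    linear_combination z 1 ^ 2 * Real.sin_sq_add_cos_sq (z 2)
  change (z 1 * Real.cos (z 2)) ^ 2 + (z 1 * Real.sin (z 2)) ^ 2 ≤ 1
  rw [e]
  exact pow_le_one₀ h1.1 h1.2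

theorem cylCoord_mem_interior {s : Set ℝ} (hs : IsOpen s) {z : Fin 3 → ℝ} (h0 : z 0 ∈ s)
    (h1 : z 1 ∈ Ioo (0 : ℝ) 1) : cylCoord z ∈ interior (s ×ˢ unitDisk) := by
  rw [interior_prod_eq, hs.interior_eq]
  refine ⟨h0, mem_interior_unitDisk ?_⟩
  have e : (z 1 * Real.cos (z 2)) ^ 2 + (z 1 * Real.sin (z 2)) ^ 2 = z 1 ^ 2 := by
    linear_combination z 1 ^ 2 * Real.sin_sq_add_cos_sq (z 2)
  change (z 1 * Real.cos (z 2)) ^ 2 + (z 1 * Real.sin (z 2)) ^ 2 < 1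
  rw [e]
  exact pow_lt_one₀ h1.1.le h1.2 two_ne_zero

end Polar

/-! ### The variation formula -/

section Variation

variable {E : Type*} [AddCommGroup E] [Module ℝ E] [TopologicalSpace E]
variable {L : Type*} [TopologicalSpace L] [ChartedSpace E L] [Group L]
variable {ω : E →ₗ[ℝ] E →ₗ[ℝ] ℂ} {h : ℝ × (ℝ × ℝ) → L}
  {A : ℝ × (ℝ × ℝ) → ℝ × (ℝ × ℝ) →ₗ[ℝ] E} {I : Set ℝ}

/-- `ω(A_ρ, A_s) = ρ ω(A_x, A_y)`: the Jacobian of polar coordinates. -/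
theorem radial_angular_eq (hω : IsTwoCocycle E L ω) (t ρ s : ℝ) :
    ω (A (cylCoord ![t, ρ, s]) (radialField ![t, ρ, s]))
        (A (cylCoord ![t, ρ, s]) (angularField ![t, ρ, s])) =
      ρ • ω (A (t, (ρ * Real.cos s, ρ * Real.sin s)) (0, (1, 0)))
        (A (t, (ρ * Real.cos s, ρ * Real.sin s)) (0, (0, 1))) := by
  have e : cylCoord ![t, ρ, s] = (t, (ρ * Real.cos s, ρ * Real.sin s)) := by simp [cylCoord]
  rw [e]
  generalize A (t, (ρ * Real.cos s, ρ * Real.sin s)) = B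
  have hlin : ∀ x y : ℝ, B (0, (x, y)) = x • B (0, (1, 0)) + y • B (0, (0, 1)) := fun x y => by
    rw [← map_smul, ← map_smul, ← map_add]
    simp
  have e1 : radialField ![t, ρ, s] = (0, (Real.cos s, Real.sin s)) := by simp [radialField]
  have e2 : angularField ![t, ρ, s] = (0, (-(ρ * Real.sin s), ρ * Real.cos s)) := by
    simp [angularField]
  have halt : ∀ ξ, ω ξ ξ = 0 := fun ξ => self_eq_neg.1 (hω.skew ξ ξ)
  rw [e1, e2, hlin, hlin (-(ρ * Real.sin s))]
  simp only [map_add, map_smul, LinearMap.add_apply, LinearMap.smul_apply, halt,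
    hω.skew (B (0, (0, 1))) (B (0, (1, 0))), Complex.real_smul]
  have hcs : (Real.sin s : ℂ) ^ 2 + (Real.cos s : ℂ) ^ 2 = 1 := by
    exact_mod_cast Real.sin_sq_add_cos_sq s
  push_cast at hcs ⊢
  linear_combination (ρ : ℂ) * ω (B (0, (1, 0))) (B (0, (0, 1))) * hcs

variable [IsTopologicalAddGroup E] [ContinuousSMul ℝ E] [T2Space E]

theorem IsMaurerCartanOn.pullback_eq (hA : IsMaurerCartanOn h A (I ×ˢ unitDisk)) {t : ℝ}
    (ht : t ∈ I) {q : ℝ × ℝ} (hq : q ∈ interior unitDisk) :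
    pullback ω (fun p => h (t, p)) q = ω (A (t, q) (0, (1, 0))) (A (t, q) (0, (0, 1))) := by
  have hx : leftLogDeriv E (fun x : ℝ => h (t, (x, q.2))) q.1 = A (t, q) (0, (1, 0)) := by
    refine hA.leftLogDeriv_eq (γ := fun x => (t, (x, q.2)))
      ((hasDerivAt_const _ t).prodMk ((hasDerivAt_id _).prodMk (hasDerivAt_const _ q.2))) ?_
    have hc : ContinuousAt (fun x : ℝ => (x, q.2)) q.1 := by fun_prop
    filter_upwards [hc (mem_interior_iff_mem_nhds.1 hq)] with x hx using ⟨ht, hx⟩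
  have hy : leftLogDeriv E (fun y : ℝ => h (t, (q.1, y))) q.2 = A (t, q) (0, (0, 1)) := by
    refine hA.leftLogDeriv_eq (γ := fun y => (t, (q.1, y)))
      ((hasDerivAt_const _ t).prodMk ((hasDerivAt_const _ q.1).prodMk (hasDerivAt_id _))) ?_
    have hc : ContinuousAt (fun y : ℝ => (q.1, y)) q.2 := by fun_prop
    filter_upwards [hc (mem_interior_iff_mem_nhds.1 hq)] with x hx using ⟨ht, hx⟩
  rw [← hx, ← hy]
  rfl

theorem IsMaurerCartanOn.pullback_ae_eq (hA : IsMaurerCartanOn h A (I ×ˢ unitDisk)) {t : ℝ}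
    (ht : t ∈ I) : pullback ω (fun p => h (t, p)) =ᵐ[volume.restrict unitDisk]
      fun q => ω (A (t, q) (0, (1, 0))) (A (t, q) (0, (0, 1))) := by
  rw [EventuallyEq, ae_restrict_iff' isClosed_unitDisk.measurableSet]
  -- On the circle `leftLogDeriv` may be a junk value: horizontal and vertical lines leave the disk.
  have h0 := measure_eq_zero_iff_ae_notMem.1 (convex_unitDisk.addHaar_frontier volume)
  filter_upwards [h0] with q hq hqd
  refine hA.pullback_eq ht ?_
  by_contra hqi
  exact hq ⟨subset_closure hqd, hqi⟩

theorem IsMaurerCartanOn.leftLogDeriv_boundary (hA : IsMaurerCartanOn h A (I ×ˢ unitDisk))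
    (hI : IsOpen I) {t : ℝ} (ht : t ∈ I) (s : ℝ) :
    leftLogDeriv E (fun t' : ℝ => h (t', (Real.cos s, Real.sin s))) t =
        A (cylCoord ![t, 1, s]) (1, (0, 0)) ∧
      leftLogDeriv E (fun s' : ℝ => h (t, (Real.cos s', Real.sin s'))) s =
        A (cylCoord ![t, 1, s]) (angularField ![t, 1, s]) := by
  have hmem : ∀ s, (Real.cos s, Real.sin s) ∈ unitDisk := fun s => (Real.cos_sq_add_sin_sq s).le
  have e : cylCoord ![t, 1, s] = (t, (Real.cos s, Real.sin s)) := by simp [cylCoord]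
  have e' : angularField ![t, 1, s] = (0, (-Real.sin s, Real.cos s)) := by simp [angularField]
  rw [e, e']
  constructor
  · refine hA.leftLogDeriv_eq (γ := fun t' => (t', (Real.cos s, Real.sin s)))
      ((hasDerivAt_id _).prodMk (hasDerivAt_const t (Real.cos s, Real.sin s))) ?_
    filter_upwards [hI.mem_nhds ht] with t' ht' using ⟨ht', hmem s⟩
  · exact hA.leftLogDeriv_eq (γ := fun s' => (t, (Real.cos s', Real.sin s')))
      ((hasDerivAt_const _ t).prodMk ((Real.hasDerivAt_cos s).prodMk (Real.hasDerivAt_sin s)))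
      (Eventually.of_forall fun s' => ⟨ht, hmem s'⟩)

variable [LocallyConvexSpace ℝ E] [IsLieGroup E L]

theorem IsMaurerCartanOn.hasDerivAt_integral (hω : IsTwoCocycle E L ω)
    (hA : IsMaurerCartanOn h A (I ×ˢ unitDisk)) (hc : ContinuousOn h (I ×ˢ unitDisk))
    (hI : IsOpen I) {ε : ℝ} (hε : ε ∈ I) :
    HasDerivAt (fun t => ∫ q in unitDisk, ω (A (t, q) (0, (1, 0))) (A (t, q) (0, (0, 1))))
      (∫ s in (-Real.pi)..Real.pi, ω (A (cylCoord ![ε, 1, s]) (1, (0, 0)))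
        (A (cylCoord ![ε, 1, s]) (angularField ![ε, 1, s]))) ε := by
  obtain ⟨δ, hδ, hδI⟩ := Metric.isOpen_iff.1 hI ε hε
  set a := ε - δ / 2
  set b := ε + δ / 2
  have habI : Icc a b ⊆ I := fun t ht => hδI <| by
    rw [Metric.mem_ball, Real.dist_eq, abs_lt]
    have h1 : ε - δ / 2 ≤ t := ht.1
    have h2 : t ≤ ε + δ / 2 := ht.2
    constructor <;> linarith
  have hcont : ∀ {X Y : (Fin 3 → ℝ) → ℝ × (ℝ × ℝ)}, Continuous X → Continuous Y →
      ContinuousOn (fun z => ω (A (cylCoord z) (X z)) (A (cylCoord z) (Y z)))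
        {z | z 0 ∈ Icc a b ∧ z 1 ∈ Icc (0 : ℝ) 1} := by
    intro X Y hX hY
    have hX' : ∀ {X : (Fin 3 → ℝ) → ℝ × (ℝ × ℝ)}, Continuous X →
        ContinuousOn (fun z => A (cylCoord z) (X z))
          {z | z 0 ∈ Icc a b ∧ z 1 ∈ Icc (0 : ℝ) 1} := fun {X} hX =>
      hA.continuousOn.comp (f := fun z => (cylCoord z, X z))
        (continuous_cylCoord.prodMk hX).continuousOn
        fun z hz => ⟨cylCoord_mem (habI hz.1) hz.2, mem_univ _⟩
    exact hω.continuous.comp_continuousOn ((hX' hX).prodMk (hX' hY))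
  refine hasDerivAt_of_forall_sub_eq (a := a) (b := b) (c := -Real.pi) (d := Real.pi)
    (θ := fun p => ω (A (cylCoord ![p.1, 1, p.2]) (1, (0, 0)))
        (A (cylCoord ![p.1, 1, p.2]) (angularField ![p.1, 1, p.2])))
    (by linarith [Real.pi_pos]) ?_ ?_ ⟨by simp only [a]; linarith, by simp only [b]; linarith⟩
  · refine (hcont continuous_const continuous_angularField).comp (f := fun p : ℝ × ℝ =>
      (![p.1, 1, p.2] : Fin 3 → ℝ)) (Continuous.continuousOn ?_) fun p hp => ⟨hp.1, by simp⟩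
    refine continuous_pi fun i => ?_
    fin_cases i
    exacts [continuous_fst, continuous_const, continuous_snd]
  · intro t ht
    simp only [setIntegral_unitDisk_eq_polar]
    have hsub : Icc (![a, 0, -Real.pi] : Fin 3 → ℝ) ![t, 1, Real.pi] ⊆
        {z | z 0 ∈ Icc a b ∧ z 1 ∈ Icc (0 : ℝ) 1} := fun z hz =>
      ⟨⟨hz.1 0, (hz.2 0).trans ht.2⟩, hz.1 1, hz.2 1⟩
    have key := integral_sub_eq_of_closed ht.1
      ((hcont continuous_radialField continuous_angularField).mono hsub)
      ((hcont (continuous_const (y := ((1, (0, 0)) : ℝ × (ℝ × ℝ))))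
        continuous_angularField).mono hsub)
      ((hcont (continuous_const (y := ((1, (0, 0)) : ℝ × (ℝ × ℝ))))
        continuous_radialField).mono hsub) ?_ ?_ ?_
    · simpa only [radial_angular_eq hω] using key
    · intro z h0 h1
      obtain ⟨p', hp, hp0, hp1, hp2⟩ := exists_hasFDerivAt_cylCoord z
      obtain ⟨X₁', hX₁, h10, h12⟩ := exists_hasFDerivAt_radialField z
      obtain ⟨X₂', hX₂, h20, h21⟩ := exists_hasFDerivAt_angularField z
      exact hA.exists_hasFDerivAt_closed hω hc continuous_cylCoord.continuousAt
        (cylCoord_mem_interior hI (habI ⟨h0.1.le, h0.2.le.trans ht.2⟩) h1)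
        (hasHadamardDerivWithinAt_of_hasFDerivAt hp)
        (hasHadamardDerivWithinAt_const ((1, (0, 0)) : ℝ × (ℝ × ℝ)))
        (hasHadamardDerivWithinAt_of_hasFDerivAt hX₁) (hasHadamardDerivWithinAt_of_hasFDerivAt hX₂)
        hp0 hp1 hp2 h10.symm h20.symm (h12.trans h21.symm)
    · intro ε' s
      have : angularField ![ε', 0, s] = 0 := by simp [angularField]
      rw [this, map_zero, map_zero]
    · intro ε' ρ
      have e1 : cylCoord ![ε', ρ, Real.pi] = cylCoord ![ε', ρ, -Real.pi] := by simp [cylCoord]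
      have e2 : radialField ![ε', ρ, Real.pi] = radialField ![ε', ρ, -Real.pi] := by
        simp [radialField]
      rw [e1, e2]

end Variation

end LCLie

open LCLie in
theorem theorem3p4
    {E : Type*} [AddCommGroup E] [Module ℝ E] [TopologicalSpace E] [IsTopologicalAddGroup E]
    [ContinuousSMul ℝ E] [LocallyConvexSpace ℝ E] [T2Space E]
    {L : Type*} [TopologicalSpace L] [ChartedSpace E L] [Group L] [IsLieGroup E L]
    (ω : E →ₗ[ℝ] E →ₗ[ℝ] ℂ) (hω : IsTwoCocycle E L ω)
    (r : ℝ) (h : ℝ × (ℝ × ℝ) → L)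
    (hh : SmoothMapOn E h (Ioo (-r) r ×ˢ unitDisk)) :
    ∀ ε ∈ Ioo (-r) r,
      IntegrableOn (pullback ω (fun p => h (ε, p))) unitDisk ∧
      IntervalIntegrable (fun s : ℝ =>
        ω (leftLogDeriv E (fun ε' : ℝ => h (ε', (Real.cos s, Real.sin s))) ε)
          (leftLogDeriv E (fun s' : ℝ => h (ε, (Real.cos s', Real.sin s'))) s))
        volume 0 (2 * Real.pi) ∧
      HasDerivAt (fun ε' : ℝ => ∫ p in unitDisk, pullback ω (fun q => h (ε', q)) p)
        (∫ s in (0 : ℝ)..(2 * Real.pi),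
          ω (leftLogDeriv E (fun ε' : ℝ => h (ε', (Real.cos s, Real.sin s))) ε)
            (leftLogDeriv E (fun s' : ℝ => h (ε, (Real.cos s', Real.sin s'))) s)) ε := by
  intro ε hε
  have hI : IsOpen (Ioo (-r) r) := isOpen_Ioo
  have hSi : (interior (Ioo (-r) r ×ˢ unitDisk)).Nonempty := by
    rw [interior_prod_eq, hI.interior_eq]
    exact ⟨(ε, (0, 0)), hε, mem_interior_unitDisk (by norm_num)⟩
  obtain ⟨A, hA⟩ := exists_isMaurerCartanOn hh ((convex_Ioo _ _).prod convex_unitDisk) hSi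
  set θ : ℝ → ℂ := fun s => ω (A (cylCoord ![ε, 1, s]) (1, (0, 0)))
    (A (cylCoord ![ε, 1, s]) (angularField ![ε, 1, s]))
  have hθ : (fun s : ℝ => ω (leftLogDeriv E (fun ε' : ℝ => h (ε', (Real.cos s, Real.sin s))) ε)
      (leftLogDeriv E (fun s' : ℝ => h (ε, (Real.cos s', Real.sin s'))) s)) = θ := by
    ext s
    obtain ⟨h1, h2⟩ := hA.leftLogDeriv_boundary hI hε s
    rw [h1, h2]
  have hz : Continuous fun s : ℝ => (![ε, 1, s] : Fin 3 → ℝ) := by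
    refine continuous_pi fun i => ?_
    fin_cases i
    exacts [continuous_const, continuous_const, continuous_id]
  have hAc : ∀ {X : (Fin 3 → ℝ) → ℝ × (ℝ × ℝ)}, Continuous X →
      Continuous fun s : ℝ => A (cylCoord ![ε, 1, s]) (X ![ε, 1, s]) := fun {X} hX =>
    hA.continuousOn.comp_continuous (f := fun s : ℝ => (cylCoord ![ε, 1, s], X ![ε, 1, s]))
      ((continuous_cylCoord.comp hz).prodMk (hX.comp hz))
      fun s => ⟨cylCoord_mem hε (by simp), mem_univ _⟩
  have hθc : Continuous θ := hω.continuous.comp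
    ((hAc (continuous_const (y := ((1, (0, 0)) : ℝ × (ℝ × ℝ))))).prodMk
      (hAc continuous_angularField))
  have hθp : Function.Periodic θ (2 * Real.pi) := fun s => by
    have e1 : cylCoord ![ε, 1, s + 2 * Real.pi] = cylCoord ![ε, 1, s] := by simp [cylCoord]
    have e2 : angularField ![ε, 1, s + 2 * Real.pi] = angularField ![ε, 1, s] := by
      simp [angularField]
    simp only [θ, e1, e2]
  rw [hθ]
  refine ⟨?_, hθc.intervalIntegrable _ _, ?_⟩
  · have hq : ∀ v : ℝ × (ℝ × ℝ), ContinuousOn (fun q => A (ε, q) v) unitDisk := fun v =>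
      hA.continuousOn.comp (f := fun q => ((ε, q), v)) (by fun_prop)
        fun q hq => ⟨⟨hε, hq⟩, mem_univ _⟩
    exact ((hω.continuous.comp_continuousOn ((hq _).prodMk (hq _))).integrableOn_compact
      isCompact_unitDisk).congr (hA.pullback_ae_eq hε).symm
  · have h1 := hA.hasDerivAt_integral hω hh.1 hI hε
    have h2 : ∫ s in (0 : ℝ)..(2 * Real.pi), θ s = ∫ s in (-Real.pi)..Real.pi, θ s := by
      have := hθp.intervalIntegral_add_eq 0 (-Real.pi)
      rwa [zero_add, show -Real.pi + 2 * Real.pi = Real.pi by ring] at this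
    rw [h2]
    refine h1.congr_of_eventuallyEq ?_
    filter_upwards [hI.mem_nhds hε] with t ht
    exact integral_congr_ae (hA.pullback_ae_eq ht)
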